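/- Let $(M,d,m)$ be a complete, connected, non-compact smooth Riemannian manifold (second countable) with Riemannian distance $d$ and Riemannian volume measure $m$, and let $G$ be a group of isometries of $M$ whose action is properly discontinuous (for $x\in M$ and $K\subset M$ compact, $gx\in K$ for only finitely many $g\in G$), cocompact ($M/G$ is compact) and free. Let $(\Omega,\mathfrak A,\mathbb P)$ be a probability space with a measurable flow $(\theta_g)_{g\in G}$, $\theta_e=\mathrm{id}$, $\theta_g\circ\theta_h=\theta_{gh}$, such that $\mathbb P$ is stationary, i.e. $\mathbb P\circ\theta_g=\mathbb P$ for all $g\in G$. A random measure on $X=M$ or $X=M\times M$ is a measurable map $\omega\mapsto\kappa^\omega$ from $\Omega$ to the Radon measures on $X$. It is equivariant if $\kappa^{\theta_g\omega}(gA)=\kappa^\omega(A)$ for all $g\in G$, $\omega\in\Omega$ and Borel $A\subset X$, where $G$ acts diagonally on $M\times M$. A random measure $\lambda^\bullet$ on $M$ has unit intensity if $\mathbb E[\lambda^\bullet(A)]=m(A)$ for all Borel $A\subset M$. An equivariant semicoupling of two random measures $\lambda^\bullet,\mu^\bullet$ on $M$ is an equivariant random measure $q^\bullet$ on $M\times M$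 such that, for $\mathbb P$-a.e. $\omega$, the first marginal of $q^\omega$ is $\le\lambda^\omega$ and the second marginal is equal to $\mu^\omega$; it is a coupling if, for $\mathbb P$-a.e. $\omega$, the first marginal is equal to $\lambda^\omega$. Write $\Pi_{es}(\lambda^\bullet,\mu^\bullet)$ for the set of equivariant semicouplings. A fundamental region is a Borel set $F\subset M$ with $\bigcup_{g\in G}gF=M$ and $F\cap gF=\emptyset$ for $g\ne e$, and $\mathrm{Adm}(M)$ is the collection of all sets $B=\bigcup_{g\in I}gF$ with $F$ a fundamental region and $I\subset G$ finite and non-empty. For $p\in[1,\infty)$ put $$\mathfrak C(q^\bullet)=\sup_{B\in\mathrm{Adm}(M)}\frac1{m(B)}\,\mathbb E\Big[\int_{M\times B}d(x,y)^p\,q^\bullet(dx,dy)\Big],\qquad \mathbb W_p(\lambda^\bullet,\mu^\bullet)=\Big(\inf_{q^\bullet\in\Pi_{es}(\lambda^\bullet,\mu^\bullet)}\mathfrak C(q^\bullet)\Big)^{1/p}\in[0,\infty].$$ Let $\lambda^\bullet,\mu^\bullet,\xi^\bullet$ be three equivariant random measures on $M$ of unit intensity, and let $p\in[1,\infty)$.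 Then 1. $\mathbb W_p(\lambda^\bullet,\mu^\bullet)=0$ if and only if $\lambda^\omega=\mu^\omega$ for $\mathbb P$-a.e. $\omega$; 2. $\mathbb W_p(\lambda^\bullet,\mu^\bullet)=\mathbb W_p(\mu^\bullet,\lambda^\bullet)$; 3. $\mathbb W_p(\lambda^\bullet,\mu^\bullet)\le\mathbb W_p(\lambda^\bullet,\xi^\bullet)+\mathbb W_p(\xi^\bullet,\mu^\bullet)$. Moreover, every equivariant semicoupling of $\lambda^\bullet$ and $\mu^\bullet$ is a coupling, so that the infimum defining $\mathbb W_p(\lambda^\bullet,\mu^\bullet)$ is the infimum over all equivariant couplings. -/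

import Mathlib

open Bundle MeasureTheory ProbabilityTheory Set
open scoped ENNReal Manifold Pointwise

noncomputable section

/-! ### The Riemannian volume measure -/

section Volume

attribute [local instance 10000] chartedSpaceSelf

variable (n : ℕ) (M : Type*) [TopologicalSpace M] [ChartedSpace (EuclideanSpace ℝ (Fin n)) M]
  [RiemannianBundle (fun x : M => TangentSpace (𝓡 n) x)]

/-- The matrix `g_{ij}(u) = ⟨∂_i, ∂_j⟩` of the Riemannian metric in the coordinates given by the
chart at `x₀`, at the coordinate point `u`. -/
def chartGramMatrix (x₀ : M) (u : EuclideanSpace ℝ (Fin n)) : Matrix (Fin n) (Fin n) ℝ :=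
  Matrix.of fun i j =>
    inner ℝ
      (mfderiv 𝓘(ℝ, EuclideanSpace ℝ (Fin n)) (𝓡 n) (extChartAt (𝓡 n) x₀).symm u
        (EuclideanSpace.single i (1 : ℝ)))
      (mfderiv 𝓘(ℝ, EuclideanSpace ℝ (Fin n)) (𝓡 n) (extChartAt (𝓡 n) x₀).symm u
        (EuclideanSpace.single j (1 : ℝ)))

variable [MeasurableSpace M]

/-- The measure `√(det g_{ij}) du` of the chart at `x₀`, transported to the domain of the chart
(and zero outside that domain). -/
def chartVolume (x₀ : M) : Measure M :=
  ((volume.restrict (extChartAt (𝓡 n) x₀).target).withDensity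
    fun u => ENNReal.ofReal (Real.sqrt (chartGramMatrix n M x₀ u).det)).map (extChartAt (𝓡 n) x₀).symm

/-- The Riemannian volume measure. The measures `chartVolume n M x₀` agree on the overlaps of the
chart domains, so their least upper bound in the lattice of measures is the measure which is given
by `√(det g_{ij}) du` in every chart. -/
def riemannianVolume : Measure M := ⨆ x₀ : M, chartVolume n M x₀

end Volume

/-! ### The group action -/

section Action

variable (G : Type*) [Group G] {M : Type*} [MulAction G M]

/-- Every orbit meets every compact set for only finitely many group elements. -/
def IsProperlyDiscontinuousAction (M : Type*) [MulAction G M] [TopologicalSpace M] : Prop :=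
  ∀ (x : M) (K : Set M), IsCompact K → {g : G | g • x ∈ K}.Finite

/-- The quotient by the action is compact. -/
def IsCocompactAction (M : Type*) [MulAction G M] [TopologicalSpace M] : Prop :=
  CompactSpace (MulAction.orbitRel.Quotient G M)

/-- All stabilizers are trivial. -/
def IsFreeAction (M : Type*) [MulAction G M] : Prop :=
  ∀ (g : G) (x : M), g • x = x → g = 1

/-- A measurable set that contains exactly one point of each orbit of a free action. -/
structure IsFundamentalRegion [MeasurableSpace M] (F : Set M) : Prop where
  measurableSet : MeasurableSet F
  iUnion_smul : ⋃ g : G, g • F = univ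
  disjoint_smul : ∀ g : G, g ≠ 1 → F ∩ g • F = ∅

/-- Finite nonempty unions of translates of a fundamental region. -/
def IsAdmissible [MeasurableSpace M] (B : Set M) : Prop :=
  ∃ (F : Set M) (I : Finset G), IsFundamentalRegion G F ∧ I.Nonempty ∧ B = ⋃ g ∈ I, g • F

end Action

/-! ### Random measures and semicouplings

A random measure is a measurable family of measures, that is, a `Kernel`, with Radon values;
on a second countable, locally compact metric space the Radon measures are the locally finite Borel
measures. -/

section RandomMeasures

variable {Ω : Type*} [MeasurableSpace Ω]

/-- The values of the kernel are Radon measures. -/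
def IsRandomMeasure {X : Type*} [TopologicalSpace X] [MeasurableSpace X]
    (κ : Kernel Ω X) : Prop :=
  ∀ ω, IsLocallyFiniteMeasure (κ ω)

/-- `κ^{θ_g ω}(g A) = κ^ω(A)` for all `g`, `ω` and measurable `A`; on `M × M` the group acts
diagonally. -/
def IsEquivariant (G : Type*) [Group G] [MulAction G Ω] {X : Type*} [MulAction G X]
    [MeasurableSpace X] (κ : Kernel Ω X) : Prop :=
  ∀ (g : G) (ω : Ω) (A : Set X), MeasurableSet A → κ (g • ω) (g • A) = κ ω A

/-- The intensity measure `A ↦ E[κ(A)]` equals `m`. -/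
def HasUnitIntensity {M : Type*} [MeasurableSpace M] (P : Measure Ω) (m : Measure M)
    (κ : Kernel Ω M) : Prop :=
  ∀ A : Set M, MeasurableSet A → ∫⁻ ω, κ ω A ∂P = m A

/-- `q` is a semicoupling of `lam` and `μ`: the first marginal is at most `lam`, the second one
is `μ`. -/
def IsSemicoupling {M : Type*} [MeasurableSpace M] (q : Measure (M × M)) (lam μ : Measure M) :
    Prop :=
  q.map Prod.fst ≤ lam ∧ q.map Prod.snd = μ

/-- `q` is a coupling of `lam` and `μ`. -/
def IsCoupling {M : Type*} [MeasurableSpace M] (q : Measure (M × M)) (lam μ : Measure M) : Prop :=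
  q.map Prod.fst = lam ∧ q.map Prod.snd = μ

/-- `q` is an equivariant semicoupling of the random measures `lam` and `μ`. -/
structure IsEquivariantSemicoupling (G : Type*) [Group G] [MulAction G Ω] {M : Type*}
    [TopologicalSpace M] [MeasurableSpace M] [MulAction G M] (P : Measure Ω)
    (q : Kernel Ω (M × M)) (lam μ : Kernel Ω M) : Prop where
  isRandomMeasure : IsRandomMeasure q
  isEquivariant : IsEquivariant G q
  isSemicoupling : ∀ᵐ ω ∂P, IsSemicoupling (q ω) (lam ω) (μ ω)

/-- The mean transportation cost
`sup_B m(B)⁻¹ E[∫_{M × B} d(x, y)^p q(dx, dy)]`, the supremum being over all admissible `B`. -/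
def meanCost (G : Type*) [Group G] {M : Type*} [MetricSpace M] [MeasurableSpace M] [MulAction G M]
    (P : Measure Ω) (m : Measure M) (p : ℝ) (q : Kernel Ω (M × M)) : ℝ≥0∞ :=
  ⨆ (B : Set M) (_ : IsAdmissible G B),
    (m B)⁻¹ * ∫⁻ ω, ∫⁻ z in univ ×ˢ B, edist z.1 z.2 ^ p ∂(q ω) ∂P

/-- `𝕎_p(lam, μ)`, with values in `[0, ∞]`: the `p`-th root of the least mean transportation cost
of an equivariant semicoupling. -/
def wassersteinW (G : Type*) [Group G] [MulAction G Ω] {M : Type*} [MetricSpace M]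
    [MeasurableSpace M] [MulAction G M] (P : Measure Ω) (m : Measure M) (p : ℝ)
    (lam μ : Kernel Ω M) : ℝ≥0∞ :=
  (⨅ (q : Kernel Ω (M × M)) (_ : IsEquivariantSemicoupling G P q lam μ),
    meanCost G P m p q) ^ (1 / p)

end RandomMeasures

end

/-! The engine is the mass transport principle `IsEquivariant.mass_transport`: stationarity allows
the expected integral of an invariant function against an equivariant random measure to be localised
in a fundamental region through any equivariant coordinate. Hence all fundamental regions have the
same volume, and the supremum defining the cost is the value on one region `F` (`meanCost_eq`). The
geometry enters only through `F`: it can be chosen relatively compact, and the Riemannian volume is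
locally finite, so `F` has finite volume.

For a semicoupling, the first marginal has the same finite expected mass on every translate of `F`
as `lam`. Being at most `lam`, it equals `lam` almost surely
(`IsEquivariantSemicoupling.ae_isCoupling`). Symmetry follows by exchanging the factors, since the
cost may be localised in either coordinate.

If the distance vanishes, Markov's inequality for semicouplings of arbitrarily small cost bounds the
`lam`-mass of a set by the `μ`-mass of its thickenings. Exhausting open sets from inside and using
symmetry gives equality on open sets, hence of the measures; optimal semicouplings are not needed.
Conversely, the diagonal coupling costs nothing.

For the triangle inequality, the second semicoupling is disintegrated equivariantly over its first
marginal and glued to the first one (`IsEquivariantSemicoupling.exists_glue`). Minkowski's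
inequality is applied to the glued measure with the last coordinate in `F`; mass transport
identifies the cost of the first semicoupling, which is localised in the middle coordinate. -/

theorem norm_apply_le_of_norm_eq_one {V W : Type*} {_ : SeminormedAddCommGroup V}
    {_ : NormedSpace ℝ V} {_ : SeminormedAddCommGroup W} {_ : NormedSpace ℝ W} {D : V →L[ℝ] W}
    {C : ℝ} (hD : ‖D‖ ≤ C) {v : V} (hv : ‖v‖ = 1) : ‖D v‖ ≤ C := by
  simpa [hv] using D.le_of_opNorm_le hD v

/-! ### Local finiteness of the Riemannian volume -/

section RiemannianVolume

attribute [local instance 10000] chartedSpaceSelf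

variable {n : ℕ} {M : Type*} [TopologicalSpace M] [ChartedSpace (EuclideanSpace ℝ (Fin n)) M]

theorem measurableSet_target_inter_preimage_extChartAt_symm [MeasurableSpace M] [BorelSpace M]
    (x₀ : M) {A : Set M}
    (hA : MeasurableSet A) :
    MeasurableSet ((extChartAt (𝓡 n) x₀).target ∩ (extChartAt (𝓡 n) x₀).symm ⁻¹' A) := by
  have hopen : IsOpen (extChartAt (𝓡 n) x₀).target := isOpen_extChartAt_target x₀
  have h1 := measurableSet_preimage
    (continuousOn_extChartAt_symm (I := 𝓡 n) x₀).domRestrict.measurable hA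
  have h2 := (MeasurableEmbedding.subtype_coe hopen.measurableSet).measurableSet_image.2 h1
  convert h2 using 1
  ext u
  simp [and_comm]

section Gram

variable [RiemannianBundle (fun x : M => TangentSpace (𝓡 n) x)]

/-- The Gram matrix of the images of the standard basis vectors under the differential of a map
from Euclidean space to a manifold. -/
noncomputable def gramMatrixAt (f : EuclideanSpace ℝ (Fin n) → M) (u : EuclideanSpace ℝ (Fin n)) :
    Matrix (Fin n) (Fin n) ℝ :=
  Matrix.of fun i j =>
    inner ℝ
      (mfderiv 𝓘(ℝ, EuclideanSpace ℝ (Fin n)) (𝓡 n) f u (EuclideanSpace.single i (1 : ℝ)))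
      (mfderiv 𝓘(ℝ, EuclideanSpace ℝ (Fin n)) (𝓡 n) f u (EuclideanSpace.single j (1 : ℝ)))

/-- All tangent spaces are the same model space with point-dependent inner products; this moves the
base point without dependent rewriting. -/
theorem inner_tangentSpace_congr {y y' : M} (h : y = y') (v w : EuclideanSpace ℝ (Fin n)) :
    inner ℝ (show TangentSpace (𝓡 n) y from v) (show TangentSpace (𝓡 n) y from w)
      = inner ℝ (show TangentSpace (𝓡 n) y' from v) (show TangentSpace (𝓡 n) y' from w) := by
  subst h; rfl

theorem gramMatrixAt_congr {f g : EuclideanSpace ℝ (Fin n) → M} {u : EuclideanSpace ℝ (Fin n)}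
    (h : f =ᶠ[nhds u] g) : gramMatrixAt f u = gramMatrixAt g u := by
  have h1 := h.mfderiv_eq (I := 𝓘(ℝ, EuclideanSpace ℝ (Fin n))) (I' := 𝓡 n)
  ext i j
  simp only [gramMatrixAt, Matrix.of_apply]
  have h2 := inner_tangentSpace_congr h.eq_of_nhds
    (mfderiv 𝓘(ℝ, EuclideanSpace ℝ (Fin n)) (𝓡 n) f u (EuclideanSpace.single i (1 : ℝ)))
    (mfderiv 𝓘(ℝ, EuclideanSpace ℝ (Fin n)) (𝓡 n) f u (EuclideanSpace.single j (1 : ℝ)))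
  refine h2.trans ?_
  rw [h1]
  rfl

/-- By the chain rule the Gram matrix becomes `Jᵀ * gramMatrixAt f (ψ u) * J`, with `J` the Jacobian
matrix of `ψ`. -/
theorem det_gramMatrixAt_comp {f : EuclideanSpace ℝ (Fin n) → M}
    {ψ : EuclideanSpace ℝ (Fin n) → EuclideanSpace ℝ (Fin n)} {u : EuclideanSpace ℝ (Fin n)}
    (hf : MDifferentiableAt 𝓘(ℝ, EuclideanSpace ℝ (Fin n)) (𝓡 n) f (ψ u))
    (hψ : DifferentiableAt ℝ ψ u) :
    (gramMatrixAt (f ∘ ψ) u).det = (fderiv ℝ ψ u).det ^ 2 * (gramMatrixAt f (ψ u)).det := by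
  set b := (EuclideanSpace.basisFun (Fin n) ℝ).toBasis with hb
  set J := LinearMap.toMatrix b b (fderiv ℝ ψ u : _ →ₗ[ℝ] _) with hJ
  have hJe : ∀ i, fderiv ℝ ψ u (EuclideanSpace.single i (1 : ℝ))
      = ∑ k, J k i • EuclideanSpace.single k (1 : ℝ) := by
    intro i
    have := b.sum_repr (fderiv ℝ ψ u (b i))
    rw [← show b i = EuclideanSpace.single i (1 : ℝ) by simp [hb], ← this]
    simp [hJ, LinearMap.toMatrix_apply, hb]
  have hG : gramMatrixAt (f ∘ ψ) u = J.transpose * gramMatrixAt f (ψ u) * J := by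
    ext i j
    have hc : mfderiv 𝓘(ℝ, EuclideanSpace ℝ (Fin n)) (𝓡 n) (f ∘ ψ) u
        = (mfderiv 𝓘(ℝ, EuclideanSpace ℝ (Fin n)) (𝓡 n) f (ψ u)).comp (fderiv ℝ ψ u) := by
      rw [mfderiv_comp u hf hψ.mdifferentiableAt, mfderiv_eq_fderiv]
      rfl
    simp only [gramMatrixAt, Matrix.of_apply, Matrix.mul_apply, Matrix.transpose_apply]
    rw [hc]
    have hD : ∀ i, ((mfderiv 𝓘(ℝ, EuclideanSpace ℝ (Fin n)) (𝓡 n) f (ψ u)).comp (fderiv ℝ ψ u))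
        (EuclideanSpace.single i (1 : ℝ)) = ∑ k, J k i •
          mfderiv 𝓘(ℝ, EuclideanSpace ℝ (Fin n)) (𝓡 n) f (ψ u)
            (EuclideanSpace.single k (1 : ℝ)) := by
      intro i
      change mfderiv 𝓘(ℝ, EuclideanSpace ℝ (Fin n)) (𝓡 n) f (ψ u)
        (fderiv ℝ ψ u (EuclideanSpace.single i (1 : ℝ))) = _
      have hlin : ∀ (L : EuclideanSpace ℝ (Fin n) →L[ℝ] EuclideanSpace ℝ (Fin n)) (c : Fin n → ℝ),
          L (∑ k, c k • EuclideanSpace.single k (1 : ℝ))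
            = ∑ k, c k • L (EuclideanSpace.single k (1 : ℝ)) := by
        intro L c
        simp only [map_sum, map_smul]
      rw [hJe]
      exact hlin _ _
    have hgoal : ∀ v w : Fin n → TangentSpace (𝓡 n) (f (ψ u)),
        inner ℝ (∑ k, J k i • v k) (∑ k, J k j • w k)
          = ∑ k, (∑ l, J l i * inner ℝ (v l) (w k)) * J k j := by
      intro v w
      rw [inner_sum]
      refine Finset.sum_congr rfl fun k _ => ?_
      rw [sum_inner, Finset.sum_mul]
      refine Finset.sum_congr rfl fun l _ => ?_
      rw [real_inner_smul_left, real_inner_smul_right]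
      ring
    rw [← hgoal]
    refine (inner_tangentSpace_congr rfl _ _).trans ?_
    exact congrArg₂ (inner ℝ) (hD i) (hD j)
  rw [hG, Matrix.det_mul, Matrix.det_mul, Matrix.det_transpose, hJ, LinearMap.det_toMatrix]
  change LinearMap.det _ * _ * LinearMap.det _ = LinearMap.det _ ^ 2 * _
  ring

theorem chartGramMatrix_eq_gramMatrixAt (x₀ : M) (u : EuclideanSpace ℝ (Fin n)) :
    chartGramMatrix n M x₀ u = gramMatrixAt (extChartAt (𝓡 n) x₀).symm u := rfl

variable [MeasurableSpace M] [BorelSpace M]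

theorem chartVolume_apply (x₀ : M) {A : Set M} (hA : MeasurableSet A) :
    chartVolume n M x₀ A
      = ∫⁻ u in (extChartAt (𝓡 n) x₀).target ∩ (extChartAt (𝓡 n) x₀).symm ⁻¹' A,
          ENNReal.ofReal (Real.sqrt (chartGramMatrix n M x₀ u).det) := by
  have hcont := continuousOn_extChartAt_symm (I := 𝓡 n) x₀
  have hopen : IsOpen (extChartAt (𝓡 n) x₀).target := isOpen_extChartAt_target x₀
  have hae : AEMeasurable (extChartAt (𝓡 n) x₀).symm
      (volume.restrict (extChartAt (𝓡 n) x₀).target) := hcont.aemeasurable hopen.measurableSet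
  have hae' : AEMeasurable (extChartAt (𝓡 n) x₀).symm
      ((volume.restrict (extChartAt (𝓡 n) x₀).target).withDensity
        fun u => ENNReal.ofReal (Real.sqrt (chartGramMatrix n M x₀ u).det)) :=
    hae.mono_ac (withDensity_absolutelyContinuous _ _)
  have hS := measurableSet_target_inter_preimage_extChartAt_symm (n := n) x₀ hA
  have h0 : (volume.restrict (extChartAt (𝓡 n) x₀).target).withDensity
        (fun u => ENNReal.ofReal (Real.sqrt (chartGramMatrix n M x₀ u).det))
        (extChartAt (𝓡 n) x₀).targetᶜ = 0 := by
    apply withDensity_absolutelyContinuous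
    rw [Measure.restrict_apply hopen.measurableSet.compl, compl_inter_self, measure_empty]
  rw [chartVolume, Measure.map_apply_of_aemeasurable hae' hA, ← measure_inter_conull h0,
    inter_comm, withDensity_apply _ hS, Measure.restrict_restrict hS,
    inter_eq_self_of_subset_left inter_subset_left]

/-- Change of variables along the transition map: the root of the squared Jacobian is exactly the
factor in the area formula. Only an inequality results, because `A` may leave the chart domain at
`x₀`. -/
theorem chartVolume_le_of_subset_source [IsManifold (𝓡 n) 1 M] (x₀ x₁ : M) {A : Set M}
    (hA : MeasurableSet A) (hA₁ : A ⊆ (extChartAt (𝓡 n) x₁).source) :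
    chartVolume n M x₀ A ≤ chartVolume n M x₁ A := by
  set S := (extChartAt (𝓡 n) x₀).target ∩ (extChartAt (𝓡 n) x₀).symm ⁻¹' A with hSdef
  have hS : MeasurableSet S := measurableSet_target_inter_preimage_extChartAt_symm x₀ hA
  set ψ : EuclideanSpace ℝ (Fin n) → EuclideanSpace ℝ (Fin n) :=
    extChartAt (𝓡 n) x₁ ∘ (extChartAt (𝓡 n) x₀).symm with hψ
  have hmd : ∀ u ∈ S, MDifferentiableAt 𝓘(ℝ, EuclideanSpace ℝ (Fin n)) (𝓡 n)
      (extChartAt (𝓡 n) x₀).symm u := fun u hu =>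
    ((contMDiffOn_extChartAt_symm (n := 1) x₀).contMDiffAt
      ((isOpen_extChartAt_target x₀).mem_nhds hu.1)).mdifferentiableAt one_ne_zero
  have hmd₁ : ∀ u ∈ S, MDifferentiableAt 𝓘(ℝ, EuclideanSpace ℝ (Fin n)) (𝓡 n)
      (extChartAt (𝓡 n) x₁).symm (ψ u) := fun u hu =>
    ((contMDiffOn_extChartAt_symm (n := 1) x₁).contMDiffAt
      ((isOpen_extChartAt_target x₁).mem_nhds
        ((extChartAt (𝓡 n) x₁).map_source (hA₁ hu.2)))).mdifferentiableAt one_ne_zero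
  have hψd : ∀ u ∈ S, DifferentiableAt ℝ ψ u := fun u hu => by
    rw [← mdifferentiableAt_iff_differentiableAt]
    refine MDifferentiableAt.comp u ?_ (hmd u hu)
    exact mdifferentiableAt_extChartAt (by simpa using hA₁ hu.2)
  have hev : ∀ u ∈ S, ((extChartAt (𝓡 n) x₁).symm ∘ ψ)
      =ᶠ[nhds u] (extChartAt (𝓡 n) x₀).symm := fun u hu => by
    have hc : ContinuousAt (extChartAt (𝓡 n) x₀).symm u :=
      (continuousOn_extChartAt_symm x₀).continuousAt
        ((isOpen_extChartAt_target x₀).mem_nhds hu.1)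
    filter_upwards [hc.preimage_mem_nhds ((isOpen_extChartAt_source x₁).mem_nhds (hA₁ hu.2))]
      with v hv
    exact (extChartAt (𝓡 n) x₁).left_inv hv
  have hinj : InjOn ψ S := by
    intro u hu v hv huv
    have h1 := (extChartAt (𝓡 n) x₁).injOn (hA₁ hu.2) (hA₁ hv.2) huv
    exact (extChartAt (𝓡 n) x₀).symm.injOn hu.1 hv.1 h1
  have himg : ψ '' S ⊆ (extChartAt (𝓡 n) x₁).target ∩ (extChartAt (𝓡 n) x₁).symm ⁻¹' A := by
    rintro _ ⟨u, hu, rfl⟩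
    refine ⟨(extChartAt (𝓡 n) x₁).map_source (hA₁ hu.2), ?_⟩
    have := (extChartAt (𝓡 n) x₁).left_inv (hA₁ hu.2)
    simpa only [mem_preimage, hψ, Function.comp_apply, this] using hu.2
  have hdet : ∀ u ∈ S, ENNReal.ofReal (Real.sqrt (chartGramMatrix n M x₀ u).det)
      = ENNReal.ofReal |(fderiv ℝ ψ u).det|
        * ENNReal.ofReal (Real.sqrt (chartGramMatrix n M x₁ (ψ u)).det) := fun u hu => by
    rw [chartGramMatrix_eq_gramMatrixAt, chartGramMatrix_eq_gramMatrixAt,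
      ← gramMatrixAt_congr (hev u hu), det_gramMatrixAt_comp (hmd₁ u hu) (hψd u hu),
      Real.sqrt_mul (sq_nonneg _), Real.sqrt_sq_eq_abs, ENNReal.ofReal_mul (abs_nonneg _)]
  rw [chartVolume_apply x₀ hA, chartVolume_apply x₁ hA, setLIntegral_congr_fun hS hdet,
    ← lintegral_image_eq_lintegral_abs_det_fderiv_mul volume hS
      (fun u hu => (hψd u hu).hasFDerivAt.hasFDerivWithinAt) hinj
      (fun v => ENNReal.ofReal (Real.sqrt (chartGramMatrix n M x₁ v).det))]
  exact lintegral_mono_set himg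

/-- A supremum of measures is not a setwise supremum, so one measure dominating every chart measure
is needed: the chart measure at `x₀`, plus the top measure off its domain, which does not charge
`A`. -/
theorem riemannianVolume_le_of_subset_source [IsManifold (𝓡 n) 1 M] (x₀ : M) {A : Set M}
    (hA : MeasurableSet A) (hA₀ : A ⊆ (extChartAt (𝓡 n) x₀).source) :
    riemannianVolume n M A ≤ chartVolume n M x₀ A := by
  have hU : MeasurableSet (extChartAt (𝓡 n) x₀).source :=
    (isOpen_extChartAt_source x₀).measurableSet
  have h : riemannianVolume n M
      ≤ chartVolume n M x₀ + (⊤ : Measure M).restrict (extChartAt (𝓡 n) x₀).sourceᶜ := by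
    refine iSup_le fun x => Measure.le_iff.2 fun B hB => ?_
    rw [← measure_inter_add_sdiff B hU, Measure.add_apply, Measure.restrict_apply hB]
    refine add_le_add ?_ ?_
    · exact (chartVolume_le_of_subset_source x x₀ (hB.inter hU) inter_subset_right).trans
        (measure_mono inter_subset_left)
    · exact Measure.le_iff.1 le_top _ (hB.diff hU)
  refine (h A).trans ?_
  rw [Measure.add_apply, Measure.restrict_apply hA]
  have : A ∩ (extChartAt (𝓡 n) x₀).sourceᶜ = ∅ := by
    rw [← sdiff_eq, sdiff_eq_empty]; exact hA₀
  rw [this, measure_empty, add_zero]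

/-- Near `x₀` the differential of the inverse chart has norm below some `C`, so the Gram entries are
at most `C * C` and the density is bounded on a coordinate ball. -/
theorem isLocallyFiniteMeasure_riemannianVolume [IsManifold (𝓡 n) 1 M]
    [IsContinuousRiemannianBundle (EuclideanSpace ℝ (Fin n))
      (fun x : M => TangentSpace (𝓡 n) x)] :
    IsLocallyFiniteMeasure (riemannianVolume n M) := by
  refine ⟨fun x₀ => ?_⟩
  obtain ⟨C, hC, hev⟩ := eventually_norm_mfderivWithin_symm_extChartAt_lt (𝓡 n) x₀
  rw [ModelWithCorners.Boundaryless.range_eq_univ, nhdsWithin_univ] at hev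
  obtain ⟨r, hr, hball⟩ := Metric.eventually_nhds_iff_ball.1 hev
  set V := (extChartAt (𝓡 n) x₀).source ∩
    extChartAt (𝓡 n) x₀ ⁻¹' Metric.ball (extChartAt (𝓡 n) x₀ x₀) r with hV
  have hVo : IsOpen V := (continuousOn_extChartAt x₀).isOpen_inter_preimage
    (isOpen_extChartAt_source x₀) Metric.isOpen_ball
  refine ⟨V, hVo.mem_nhds ⟨mem_extChartAt_source x₀, by simpa using hr⟩, ?_⟩
  refine (riemannianVolume_le_of_subset_source x₀ hVo.measurableSet inter_subset_left).trans_lt ?_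
  have hsub : (extChartAt (𝓡 n) x₀).target ∩ (extChartAt (𝓡 n) x₀).symm ⁻¹' V
      ⊆ Metric.ball (extChartAt (𝓡 n) x₀ x₀) r := by
    rintro u ⟨hu, hu'⟩
    have := hu'.2
    rwa [mem_preimage, (extChartAt (𝓡 n) x₀).right_inv hu] at this
  have hbound : ∀ u ∈ (extChartAt (𝓡 n) x₀).target ∩ (extChartAt (𝓡 n) x₀).symm ⁻¹' V,
      ENNReal.ofReal (Real.sqrt (chartGramMatrix n M x₀ u).det)
        ≤ ENNReal.ofReal (Real.sqrt (n.factorial * (C * C) ^ n)) := by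
    intro u hu
    refine ENNReal.ofReal_le_ofReal (Real.sqrt_le_sqrt ?_)
    have hn := hball u (hsub hu)
    have hent : ∀ i j, AbsoluteValue.abs (chartGramMatrix n M x₀ u i j) ≤ C * C := by
      intro i j
      rw [mfderivWithin_univ] at hn
      have he : ∀ i, ‖mfderiv 𝓘(ℝ, EuclideanSpace ℝ (Fin n)) (𝓡 n) (extChartAt (𝓡 n) x₀).symm u
          (EuclideanSpace.single i (1 : ℝ))‖ ≤ C := fun i => by
        refine norm_apply_le_of_norm_eq_one hn.le ?_
        exact (PiLp.norm_single 2 (fun _ => ℝ) i (1 : ℝ)).trans norm_one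
      exact (abs_real_inner_le_norm _ _).trans
        (mul_le_mul (he i) (he j) (norm_nonneg _) hC.le)
    have := Matrix.det_le (abv := AbsoluteValue.abs) hent
    refine (le_abs_self _).trans (this.trans_eq ?_)
    simp
  rw [chartVolume_apply x₀ hVo.measurableSet]
  refine (setLIntegral_mono_ae' (measurableSet_target_inter_preimage_extChartAt_symm x₀
    hVo.measurableSet) (Filter.Eventually.of_forall hbound)).trans_lt ?_
  rw [setLIntegral_const]
  exact ENNReal.mul_lt_top ENNReal.ofReal_lt_top
    ((measure_mono hsub).trans_lt measure_ball_lt_top)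

end Gram

end RiemannianVolume

/-! ### A relatively compact fundamental region -/

section FundamentalRegion

variable {G : Type*} [Group G] {M : Type*} [MulAction G M]

theorem IsProperlyDiscontinuousAction.countable [TopologicalSpace M] [SigmaCompactSpace M]
    [Nonempty M] (h : IsProperlyDiscontinuousAction G M) : Countable G := by
  obtain ⟨x⟩ := ‹Nonempty M›
  have h1 : (⋃ n, {g : G | g • x ∈ compactCovering M n}) = univ := by
    refine eq_univ_of_forall fun g => ?_
    obtain ⟨n, hn⟩ := exists_mem_compactCovering (g • x)
    exact mem_iUnion.2 ⟨n, hn⟩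
  rw [← countable_univ_iff, ← h1]
  exact countable_iUnion fun n => (h x _ (isCompact_compactCovering M n)).countable

/-- Only finitely many `g` keep `x` in a compact neighbourhood, and by freeness those other than `1`
move it by more than some `δ > 0`. Since the action is isometric, a ball of radius `δ / 2` cannot
meet its other translates. -/
theorem exists_open_precompact_disjoint_translates [MetricSpace M] [LocallyCompactSpace M]
    [IsIsometricSMul G M] (hdisc : IsProperlyDiscontinuousAction G M) (hfree : IsFreeAction G M)
    (x : M) : ∃ U : Set M, IsOpen U ∧ x ∈ U ∧ IsCompact (closure U) ∧
      ∀ g : G, g ≠ 1 → ∀ y ∈ U, g • y ∉ U := by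
  obtain ⟨K, hK, hxK⟩ := exists_compact_mem_nhds x
  obtain ⟨r, hr, hrK⟩ := Metric.nhds_basis_closedBall.mem_iff.1 hxK
  have hS := hdisc x _ hK
  have hev : ∀ᶠ δ in nhdsWithin (0 : ℝ) (Ioi 0), ∀ g ∈ {g : G | g • x ∈ K},
      g ≠ 1 → δ < dist (g • x) x := by
    refine (Set.Finite.eventually_all hS).2 fun g _ => ?_
    by_cases hg : g = 1
    · simp [hg]
    · have : 0 < dist (g • x) x := dist_pos.2 fun h => hg (hfree g x h)
      filter_upwards [Ioo_mem_nhdsGT this] with δ hδ _ using hδ.2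
  obtain ⟨δ, hδ, hδ0, hδr⟩ := (hev.and (Ioo_mem_nhdsGT hr)).exists
  refine ⟨Metric.ball x (δ / 2), Metric.isOpen_ball, Metric.mem_ball_self (by positivity),
    hK.of_isClosed_subset isClosed_closure ?_, ?_⟩
  · exact (Metric.closure_ball_subset_closedBall.trans
      (Metric.closedBall_subset_closedBall (by linarith))).trans hrK
  · intro g hg y hy hgy
    have h1 : dist (g • x) x < δ := by
      have h2 : dist (g • x) (g • y) < δ / 2 := by
        rw [dist_smul, dist_comm]; exact hy
      have := dist_triangle (g • x) (g • y) x
      rw [Metric.mem_ball] at hgy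
      linarith
    have h3 : g • x ∈ K := hrK (Metric.mem_closedBall.2 (by linarith))
    exact absurd (hδ g h3 hg) (not_lt.2 h1.le)

/-- Cocompactness leaves finitely many such neighbourhoods to treat. They are added one at a time,
each contributing only the points whose orbits miss the set built so far. -/
theorem exists_isFundamentalRegion [MetricSpace M] [LocallyCompactSpace M] [MeasurableSpace M]
    [BorelSpace M] [IsIsometricSMul G M] [Countable G]
    (hdisc : IsProperlyDiscontinuousAction G M)
    (hfree : IsFreeAction G M) (hcocpt : IsCocompactAction G M) :
    ∃ F U : Set M, IsFundamentalRegion G F ∧ F ⊆ U ∧ IsOpen U ∧ IsCompact (closure U) := by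
  choose U hUo hxU hUc hU using exists_open_precompact_disjoint_translates hdisc hfree
  have hfin : ∀ t : Finset M, ∃ F : Set M, MeasurableSet F ∧ F ⊆ ⋃ x ∈ t, U x ∧
      (∀ y, (∃ x ∈ t, ∃ g : G, g • y ∈ U x) → ∃ g : G, g • y ∈ F) ∧
      ∀ g : G, g ≠ 1 → ∀ y ∈ F, g • y ∉ F := by
    classical
    intro t
    induction t using Finset.induction_on with
    | empty => exact ⟨∅, by simp⟩
    | insert a t _ ih =>
      obtain ⟨F, hFm, hFU, hFc, hFd⟩ := ih
      refine ⟨F ∪ (U a \ ⋃ g : G, (g • ·) ⁻¹' F), ?_, ?_, ?_, ?_⟩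
      · exact hFm.union ((hUo a).measurableSet.diff
          (MeasurableSet.iUnion fun g => (continuous_const_smul g).measurable hFm))
      · rw [Finset.set_biUnion_insert]
        exact union_subset (hFU.trans subset_union_right)
          (sdiff_subset.trans subset_union_left)
      · rintro y ⟨x, hx, g, hg⟩
        by_cases hy : ∃ g : G, g • y ∈ F
        · exact hy.imp fun _ => Or.inl
        rcases Finset.mem_insert.1 hx with rfl | hx
        · refine ⟨g, Or.inr ⟨hg, ?_⟩⟩
          simp only [mem_iUnion, mem_preimage, not_exists]
          intro k hk
          exact hy ⟨k * g, by rwa [mul_smul]⟩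
        · exact absurd (hFc y ⟨x, hx, g, hg⟩) hy
      · rintro g hg y (hy | hy) (hgy | hgy)
        · exact hFd g hg y hy hgy
        · exact hgy.2 (mem_iUnion.2 ⟨g⁻¹, by simpa using hy⟩)
        · exact hy.2 (mem_iUnion.2 ⟨g, hgy⟩)
        · exact hU a g hg y hy.1 hgy.1
  have hq : ∀ x, IsOpen ((Quotient.mk _ : M → MulAction.orbitRel.Quotient G M) '' U x) := fun x =>
    isOpenMap_quotient_mk'_mul _ (hUo x)
  have : CompactSpace (MulAction.orbitRel.Quotient G M) := hcocpt
  obtain ⟨t, ht⟩ := isCompact_univ.elim_finite_subcover _ hq (by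
    intro z _
    induction z using Quotient.inductionOn with
    | h y => exact mem_iUnion.2 ⟨y, y, hxU y, rfl⟩)
  obtain ⟨F, hFm, hFU, hFc, hFd⟩ := hfin t
  refine ⟨F, ⋃ x ∈ t, U x, ⟨hFm, ?_, ?_⟩, hFU, isOpen_biUnion fun x _ => hUo x, ?_⟩
  · refine eq_univ_of_forall fun y => ?_
    obtain ⟨x, hx, z, hz, hzy⟩ : ∃ x ∈ t, ∃ z ∈ U x,
        (Quotient.mk _ z : MulAction.orbitRel.Quotient G M) = Quotient.mk _ y := by
      simpa using ht (mem_univ (Quotient.mk _ y))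
    obtain ⟨g, rfl⟩ : z ∈ MulAction.orbit G y := Quotient.exact hzy
    obtain ⟨k, hk⟩ := hFc y ⟨x, hx, g, hz⟩
    exact mem_iUnion.2 ⟨k⁻¹, mem_inv_smul_set_iff.2 hk⟩
  · intro g hg
    rw [eq_empty_iff_forall_notMem]
    rintro _ ⟨h1, y, hy, rfl⟩
    exact hFd g hg y hy h1
  · rw [Finset.closure_biUnion]
    exact t.isCompact_biUnion fun x _ => hUc x

variable [MeasurableSpace M] {F : Set M}

theorem IsFundamentalRegion.exists_smul_mem (hF : IsFundamentalRegion G F) (x : M) :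
    ∃ g : G, g • x ∈ F := by
  obtain ⟨g, hg⟩ := mem_iUnion.1 (hF.iUnion_smul.symm ▸ mem_univ x : x ∈ ⋃ g : G, g • F)
  exact ⟨g⁻¹, mem_smul_set_iff_inv_smul_mem.1 hg⟩

theorem IsFundamentalRegion.eq_of_smul_mem (hF : IsFundamentalRegion G F) {x : M} {g h : G}
    (hg : g • x ∈ F) (hh : h • x ∈ F) : g = h := by
  by_contra hne
  have h1 := hF.disjoint_smul (g * h⁻¹) fun h1 => hne (mul_inv_eq_one.1 h1)
  have : g • x ∈ F ∩ (g * h⁻¹) • F := ⟨hg, h • x, hh, by simp [smul_smul]⟩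
  rw [h1] at this
  exact this

theorem measure_eq_of_le_of_fundamentalRegion [Countable G] {ν lam : Measure M}
    (hle : ν ≤ lam) (hF : IsFundamentalRegion G F)
    (heq : ∀ g : G, ν (g • F) = lam (g • F)) (hfin : ∀ g : G, lam (g • F) ≠ ∞) : ν = lam := by
  refine (Measure.ext_iff_of_iUnion_eq_univ hF.iUnion_smul).2 fun g => ?_
  have : IsFiniteMeasure (ν.restrict (g • F)) := ⟨by
    rw [Measure.restrict_apply_univ, heq]; exact (hfin g).lt_top⟩
  refine Measure.eq_of_le_of_measure_univ_eq (Measure.restrict_mono_measure hle _) ?_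
  rw [Measure.restrict_apply_univ, Measure.restrict_apply_univ, heq]

theorem IsFundamentalRegion.measurableSet_smul_preimage [MeasurableConstSMul G M]
    (hF : IsFundamentalRegion G F) {X : Type*} [MeasurableSpace X] {φ : X → M}
    (hφ : Measurable φ) (g : G) : MeasurableSet ((fun x => g • φ x) ⁻¹' F) :=
  hφ.const_smul g hF.measurableSet

theorem IsFundamentalRegion.lintegral_eq_tsum [Countable G] [MeasurableConstSMul G M]
    (hF : IsFundamentalRegion G F) {X : Type*} [MeasurableSpace X] {φ : X → M}
    (hφ : Measurable φ) (ν : Measure X) (f : X → ℝ≥0∞) :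
    ∫⁻ x, f x ∂ν = ∑' g : G, ∫⁻ x in (fun x => g • φ x) ⁻¹' F, f x ∂ν := by
  rw [← lintegral_iUnion fun g => hF.measurableSet_smul_preimage hφ g]
  · have hU : (⋃ g : G, (fun x => g • φ x) ⁻¹' F) = univ :=
      eq_univ_of_forall fun x => mem_iUnion.2 (hF.exists_smul_mem (φ x))
    rw [hU, Measure.restrict_univ]
  · intro g h hgh
    exact Set.disjoint_left.2 fun x hg hh => hgh (hF.eq_of_smul_mem hg hh)

end FundamentalRegion

/-! ### The mass transport principle -/

section MassTransport

variable {Ω : Type*} [MeasurableSpace Ω] {G : Type*} [Group G] [MulAction G Ω]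
  {X : Type*} [MeasurableSpace X] [MulAction G X] [MeasurableConstSMul G X]

theorem IsEquivariant.map_smul {κ : Kernel Ω X} (hκ : IsEquivariant G κ) (g : G) (ω : Ω) :
    (κ ω).map (g • ·) = κ (g • ω) := by
  ext A hA
  rw [Measure.map_apply (measurable_const_smul g) hA, preimage_smul,
    ← hκ g ω _ (hA.const_smul g⁻¹), smul_inv_smul]

theorem isEquivariant_of_map_smul {κ : Kernel Ω X}
    (h : ∀ (g : G) (ω : Ω), (κ ω).map (g • ·) = κ (g • ω)) : IsEquivariant G κ := by
  intro g ω A hA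
  rw [← h, Measure.map_apply (measurable_const_smul g) (hA.const_smul g), preimage_smul,
    inv_smul_smul]

theorem IsEquivariant.lintegral_smul {κ : Kernel Ω X} (hκ : IsEquivariant G κ) (g : G) (ω : Ω)
    {f : X → ℝ≥0∞} (hf : Measurable f) :
    ∫⁻ x, f x ∂κ (g • ω) = ∫⁻ x, f (g • x) ∂κ ω := by
  rw [← hκ.map_smul, lintegral_map hf (measurable_const_smul g)]

variable [MeasurableConstSMul G Ω] {P : Measure Ω} [SMulInvariantMeasure G Ω P]

theorem IsEquivariant.lintegral_lintegral_smul {κ : Kernel Ω X} (hκ : IsEquivariant G κ) (g : G)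
    {f : X → ℝ≥0∞} (hf : Measurable f) :
    ∫⁻ ω, ∫⁻ x, f (g • x) ∂κ ω ∂P = ∫⁻ ω, ∫⁻ x, f x ∂κ ω ∂P := by
  simp_rw [← hκ.lintegral_smul g _ hf]
  exact (measurePreserving_smul g P).lintegral_comp hf.lintegral_kernel

/-- The mass transport principle: the mean mass which an equivariant random measure assigns to an
invariant function does not depend on which marginal is localised in which fundamental region. -/
theorem IsEquivariant.mass_transport [Countable G] {M : Type*} [MeasurableSpace M] [MulAction G M]
    [MeasurableConstSMul G M] {κ : Kernel Ω X} (hκ : IsEquivariant G κ) {φ₁ φ₂ : X → M}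
    (hφ₁ : Measurable φ₁) (hφ₂ : Measurable φ₂) (hφ₁G : ∀ (g : G) x, φ₁ (g • x) = g • φ₁ x)
    (hφ₂G : ∀ (g : G) x, φ₂ (g • x) = g • φ₂ x) {f : X → ℝ≥0∞} (hf : Measurable f)
    (hfG : ∀ (g : G) x, f (g • x) = f x) {F₁ F₂ : Set M} (hF₁ : IsFundamentalRegion G F₁)
    (hF₂ : IsFundamentalRegion G F₂) :
    ∫⁻ ω, ∫⁻ x in φ₁ ⁻¹' F₁, f x ∂κ ω ∂P = ∫⁻ ω, ∫⁻ x in φ₂ ⁻¹' F₂, f x ∂κ ω ∂P := by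
  have key : ∀ {φ ψ : X → M} {A B : Set M}, Measurable φ → Measurable ψ → MeasurableSet A →
      IsFundamentalRegion G B → ∫⁻ ω, ∫⁻ x in φ ⁻¹' A, f x ∂κ ω ∂P
        = ∑' g : G, ∫⁻ ω, ∫⁻ x, {x | φ x ∈ A ∧ g • ψ x ∈ B}.indicator f x ∂κ ω ∂P := by
    intro φ ψ A B hφ hψ hA hB
    have hm : ∀ g : G, MeasurableSet {x | φ x ∈ A ∧ g • ψ x ∈ B} := fun g =>
      (hφ hA).inter (hB.measurableSet_smul_preimage hψ g)
    rw [← lintegral_tsum fun g => ((hf.indicator (hm g)).lintegral_kernel).aemeasurable]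
    refine lintegral_congr fun ω => ?_
    rw [hB.lintegral_eq_tsum hψ]
    refine tsum_congr fun g => ?_
    rw [lintegral_indicator (hm g), Measure.restrict_restrict
      (hB.measurableSet_smul_preimage hψ g), inter_comm]
    rfl
  -- Both sides are now sums over the group element carrying the other coordinate into its region.
  -- Exchanging the roles of the coordinates replaces `g` by its inverse, and stationarity under `g`
  -- matches the terms.
  rw [key hφ₁ hφ₂ hF₁.measurableSet hF₂, key hφ₂ hφ₁ hF₂.measurableSet hF₁,
    ← (Equiv.inv G).tsum_eq]
  refine tsum_congr fun g => ?_
  refine (hκ.lintegral_lintegral_smul g (hf.indicator ((hφ₁ hF₁.measurableSet).inter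
    (hF₂.measurableSet_smul_preimage hφ₂ (g⁻¹))))).symm.trans ?_
  refine lintegral_congr fun ω => lintegral_congr fun x => ?_
  have hiff : g • x ∈ φ₁ ⁻¹' F₁ ∩ (fun x => g⁻¹ • φ₂ x) ⁻¹' F₂
      ↔ x ∈ {x | φ₂ x ∈ F₂ ∧ g • φ₁ x ∈ F₁} := by
    simp only [mem_inter_iff, mem_preimage, hφ₁G, hφ₂G, inv_smul_smul]
    exact and_comm
  by_cases hx : x ∈ {x | φ₂ x ∈ F₂ ∧ g • φ₁ x ∈ F₁}
  · rw [indicator_of_mem hx, indicator_of_mem (hiff.2 hx), hfG]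
  · rw [indicator_of_notMem hx, indicator_of_notMem (mt hiff.1 hx)]

end MassTransport

/-! ### Translated regions and their common volume -/

section FundamentalRegion

variable {G : Type*} [Group G] {M : Type*} [MulAction G M] [MeasurableSpace M]
  [MeasurableConstSMul G M] {F : Set M}

theorem IsFundamentalRegion.smul (hF : IsFundamentalRegion G F) (g : G) :
    IsFundamentalRegion G (g • F) where
  measurableSet := hF.measurableSet.const_smul g
  iUnion_smul := by
    refine eq_univ_of_forall fun x => ?_
    obtain ⟨h, hh⟩ := hF.exists_smul_mem x
    refine mem_iUnion.2 ⟨h⁻¹ * g⁻¹, ?_⟩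
    rwa [smul_smul, inv_mul_cancel_right, mem_inv_smul_set_iff]
  disjoint_smul h hh := by
    rw [eq_empty_iff_forall_notMem]
    rintro x ⟨h1, h2⟩
    rw [smul_smul, mem_smul_set_iff_inv_smul_mem] at h2
    rw [mem_smul_set_iff_inv_smul_mem] at h1
    have := hF.eq_of_smul_mem h1 h2
    exact hh (by simpa using this)

theorem IsFundamentalRegion.smul_preimage (hF : IsFundamentalRegion G F) (g : G) :
    IsFundamentalRegion G ((fun x => g • x) ⁻¹' F) := by
  rw [preimage_smul]
  exact hF.smul g⁻¹

end FundamentalRegion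

theorem edist_rpow_smul {M : Type*} [PseudoEMetricSpace M] {G : Type*} [SMul G M]
    [IsIsometricSMul G M] (p : ℝ) (g : G) (z : M × M) :
    edist (g • z).1 (g • z).2 ^ p = edist z.1 z.2 ^ p := by
  rw [Prod.smul_fst, Prod.smul_snd, edist_smul_left]

theorem measurable_setLIntegral_kernel {Ω X : Type*} [MeasurableSpace Ω] [MeasurableSpace X]
    (κ : Kernel Ω X) {f : X → ℝ≥0∞} (hf : Measurable f) {s : Set X} (hs : MeasurableSet s) :
    Measurable fun ω => ∫⁻ x in s, f x ∂κ ω :=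
  hf.lintegral_kernel (κ := κ.restrict hs)

/-- Mass transport with constant function `1` and the identity as both coordinates; no invariance of
`m` has to be assumed. -/
theorem HasUnitIntensity.measure_fundamentalRegion_eq {Ω : Type*} [MeasurableSpace Ω]
    {P : Measure Ω} {G : Type*} [Group G] [Countable G] [MulAction G Ω] [MeasurableConstSMul G Ω]
    [SMulInvariantMeasure G Ω P] {M : Type*} [MeasurableSpace M] [MulAction G M]
    [MeasurableConstSMul G M] {m : Measure M} {lam : Kernel Ω M}
    (h : HasUnitIntensity P m lam) (hlam : IsEquivariant G lam) {F₁ F₂ : Set M}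
    (hF₁ : IsFundamentalRegion G F₁) (hF₂ : IsFundamentalRegion G F₂) : m F₁ = m F₂ := by
  rw [← h _ hF₁.measurableSet, ← h _ hF₂.measurableSet]
  have := hlam.mass_transport (P := P) (f := 1) measurable_id measurable_id (fun _ _ => rfl)
    (fun _ _ => rfl) measurable_const (fun _ _ => rfl) hF₁ hF₂
  simpa using this

/-! ### The cost on one region, and semicouplings as couplings -/

section Cost

variable {Ω : Type*} [MeasurableSpace Ω] {P : Measure Ω}
  {G : Type*} [Group G] [Countable G] [MulAction G Ω] [MeasurableConstSMul G Ω]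
  [SMulInvariantMeasure G Ω P]
  {M : Type*} [MetricSpace M] [SecondCountableTopology M] [MeasurableSpace M] [BorelSpace M]
  [MulAction G M] [IsIsometricSMul G M] {m : Measure M} {F : Set M}

/-- The mean transportation cost can be computed on any fundamental region. -/
theorem meanCost_eq {q : Kernel Ω (M × M)} (hq : IsEquivariant G q)
    (hF : IsFundamentalRegion G F)
    (hm : ∀ F' : Set M, IsFundamentalRegion G F' → m F' = m F) (p : ℝ) :
    meanCost G P m p q
      = (m F)⁻¹ * ∫⁻ ω, ∫⁻ z in Prod.snd ⁻¹' F, edist z.1 z.2 ^ p ∂(q ω) ∂P := by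
  have hval : ∀ B : Set M, IsAdmissible G B →
      (m B)⁻¹ * ∫⁻ ω, ∫⁻ z in univ ×ˢ B, edist z.1 z.2 ^ p ∂(q ω) ∂P
        = (m F)⁻¹ * ∫⁻ ω, ∫⁻ z in Prod.snd ⁻¹' F, edist z.1 z.2 ^ p ∂(q ω) ∂P := by
    rintro _ ⟨F', I, hF', hI, rfl⟩
    have hdisj : Set.PairwiseDisjoint (I : Set G) fun g => g • F' := by
      intro g _ h _ hgh
      refine Set.disjoint_left.2 fun x hg hh => hgh ?_
      exact inv_injective (hF'.eq_of_smul_mem (mem_smul_set_iff_inv_smul_mem.1 hg)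
        (mem_smul_set_iff_inv_smul_mem.1 hh))
    have h1 : m (⋃ g ∈ I, g • F') = I.card * m F := by
      rw [measure_biUnion_finset hdisj fun g _ => hF'.measurableSet.const_smul g,
        Finset.sum_congr rfl fun g _ => hm _ (hF'.smul g)]
      simp
    have h2 : ∫⁻ ω, ∫⁻ z in univ ×ˢ (⋃ g ∈ I, g • F'), edist z.1 z.2 ^ p ∂(q ω) ∂P
        = I.card * ∫⁻ ω, ∫⁻ z in Prod.snd ⁻¹' F, edist z.1 z.2 ^ p ∂(q ω) ∂P := by
      have h3 : ∀ ω, ∫⁻ z in univ ×ˢ (⋃ g ∈ I, g • F'), edist z.1 z.2 ^ p ∂(q ω)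
          = ∑ g ∈ I, ∫⁻ z in Prod.snd ⁻¹' (g • F'), edist z.1 z.2 ^ p ∂(q ω) := by
        intro ω
        rw [univ_prod, preimage_iUnion₂, lintegral_biUnion_finset]
        · exact fun g hg h hh hgh => (hdisj hg hh hgh).preimage _
        · exact fun g _ => measurable_snd (hF'.measurableSet.const_smul g)
      simp_rw [h3]
      rw [lintegral_finsetSum]
      · rw [Finset.sum_congr rfl fun g _ => hq.mass_transport measurable_snd measurable_snd
          (fun _ _ => rfl) (fun _ _ => rfl) (by fun_prop) (edist_rpow_smul p) (hF'.smul g) hF]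
        simp
      · intro g _
        exact measurable_setLIntegral_kernel q (by fun_prop)
          (measurable_snd (hF'.measurableSet.const_smul g))
    have hI0 : (I.card : ℝ≥0∞) ≠ 0 := by simpa using hI.ne_empty
    have hIt : (I.card : ℝ≥0∞) ≠ ∞ := ENNReal.natCast_ne_top _
    rw [h1, h2, ENNReal.mul_inv (Or.inl hI0) (Or.inl hIt), mul_comm (I.card : ℝ≥0∞)⁻¹, mul_assoc,
      ← mul_assoc (I.card : ℝ≥0∞)⁻¹, ENNReal.inv_mul_cancel hI0 hIt, one_mul]
  have hadm : IsAdmissible G F := ⟨F, {1}, hF, by simp, by simp⟩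
  rw [meanCost]
  refine le_antisymm (iSup₂_le fun B hB => (hval B hB).le) ?_
  exact (hval F hadm).symm.le.trans (le_iSup₂_of_le F hadm le_rfl)

/-- No mass of `lam` can stay unused: by mass transport the expected first-marginal mass of each
translate of `F` equals the expected `μ`-mass of `F`, which is all that `lam` has there. An almost
sure inequality with equal finite integrals is an equality, and countably many translates determine
the measure. -/
theorem IsEquivariantSemicoupling.ae_isCoupling {q : Kernel Ω (M × M)} {lam μ : Kernel Ω M}
    (hq : IsEquivariantSemicoupling G P q lam μ)
    (hlam : IsEquivariant G lam) (hlam_unit : HasUnitIntensity P m lam)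
    (hμ_unit : HasUnitIntensity P m μ)
    (hF : IsFundamentalRegion G F) (hmF : m F ≠ ∞) :
    ∀ᵐ ω ∂P, IsCoupling (q ω) (lam ω) (μ ω) := by
  have hm : ∀ g : G, m (g • F) = m F := fun g =>
    hlam_unit.measure_fundamentalRegion_eq hlam (hF.smul g) hF
  have hfst : ∀ g : G, ∫⁻ ω, (q ω).map Prod.fst (g • F) ∂P = m F := by
    intro g
    have h1 := hq.isEquivariant.mass_transport (P := P) (f := 1) measurable_fst measurable_snd
      (fun _ _ => rfl) (fun _ _ => rfl) measurable_const (fun _ _ => rfl) (hF.smul g) hF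
    simp only [Pi.one_apply, lintegral_one, Measure.restrict_apply_univ] at h1
    simp_rw [Measure.map_apply measurable_fst (hF.measurableSet.const_smul g)]
    rw [h1, ← hμ_unit _ hF.measurableSet]
    refine lintegral_congr_ae ?_
    filter_upwards [hq.isSemicoupling] with ω hω
    rw [← hω.2, Measure.map_apply measurable_snd hF.measurableSet]
  have hae : ∀ᵐ ω ∂P, ∀ g : G, (q ω).map Prod.fst (g • F) = lam ω (g • F)
      ∧ lam ω (g • F) ≠ ∞ := by
    refine ae_all_iff.2 fun g => ?_
    have hmeas : Measurable fun ω => lam ω (g • F) :=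
      lam.measurable_coe (hF.measurableSet.const_smul g)
    have hint : ∫⁻ ω, lam ω (g • F) ∂P = m F := by
      rw [hlam_unit _ (hF.measurableSet.const_smul g), hm]
    have h1 : (fun ω => (q ω).map Prod.fst (g • F)) =ᵐ[P] fun ω => lam ω (g • F) := by
      refine ae_eq_of_ae_le_of_lintegral_le ?_ (by rwa [hfst]) hmeas.aemeasurable
        (by rw [hfst, hint])
      filter_upwards [hq.isSemicoupling] with ω hω using hω.1 _
    filter_upwards [h1, ae_lt_top hmeas (by rwa [hint])] with ω h2 h3 using ⟨h2, h3.ne⟩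
  filter_upwards [hae, hq.isSemicoupling] with ω h1 h2
  exact ⟨measure_eq_of_le_of_fundamentalRegion h2.1 hF (fun g => (h1 g).1) fun g => (h1 g).2, h2.2⟩

end Cost

/-! ### Pushforwards and almost sure equality -/

section Map

theorem IsEquivariant.map {Ω : Type*} [MeasurableSpace Ω] {G : Type*} [Group G] [MulAction G Ω]
    {X Y : Type*} [MeasurableSpace X] [MulAction G X] [MeasurableConstSMul G X]
    [MeasurableSpace Y] [MulAction G Y] [MeasurableConstSMul G Y] {κ : Kernel Ω X}
    (hκ : IsEquivariant G κ) {f : X → Y} (hf : Measurable f)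
    (hfG : ∀ (g : G) x, f (g • x) = g • f x) : IsEquivariant G (κ.map f) := by
  refine isEquivariant_of_map_smul fun g ω => ?_
  rw [Kernel.map_apply _ hf, Kernel.map_apply _ hf, ← hκ.map_smul,
    Measure.map_map (measurable_const_smul g) hf, Measure.map_map hf (measurable_const_smul g)]
  congr 1
  ext x
  exact (hfG g x).symm

/-- Random measures whose values agree almost surely on every open set agree almost surely. -/
theorem IsRandomMeasure.ae_eq_of_forall_isOpen {Ω : Type*} [MeasurableSpace Ω] {P : Measure Ω}
    {X : Type*} [TopologicalSpace X] [SecondCountableTopology X] [MeasurableSpace X] [BorelSpace X]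
    {lam μ : Kernel Ω X} (hlam : IsRandomMeasure lam)
    (h : ∀ U : Set X, IsOpen U → ∀ᵐ ω ∂P, lam ω U = μ ω U) : ∀ᵐ ω ∂P, lam ω = μ ω := by
  set b := TopologicalSpace.countableBasis X
  have hb := TopologicalSpace.isBasis_countableBasis X
  -- Finite intersections turn the countable basis into a countable π-system, so a single null set
  -- serves for all of them.
  set C : Set (Set X) := (fun f => ⋂₀ f) '' {f : Set (Set X) | f.Finite ∧ f ⊆ b} with hC
  have hCb : TopologicalSpace.IsTopologicalBasis C :=
    TopologicalSpace.isTopologicalBasis_of_subbasis hb.eq_generateFrom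
  have hCc : C.Countable :=
    (Set.countable_ofPred_finite_subset (TopologicalSpace.countable_countableBasis X)).image _
  have hpi : IsPiSystem C := by
    rintro _ ⟨f, ⟨hf, hfb⟩, rfl⟩ _ ⟨f', ⟨hf', hfb'⟩, rfl⟩ _
    exact ⟨f ∪ f', ⟨hf.union hf', union_subset hfb hfb'⟩, sInter_union f f'⟩
  have hae : ∀ᵐ ω ∂P, ∀ s ∈ C, lam ω s = μ ω s :=
    (ae_ball_iff hCc).2 fun s hs => h s (hCb.isOpen hs)
  filter_upwards [hae] with ω hω
  have := hlam ω
  have hgen : ‹MeasurableSpace X› = MeasurableSpace.generateFrom C := by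
    rw [← hCb.borel_eq_generateFrom]
    exact BorelSpace.measurable_eq
  -- Members of `C` may have infinite mass (the empty intersection is the whole space); those of
  -- finite mass still cover, by local finiteness.
  refine Measure.ext_of_generateFrom_of_cover_subset (T := {s ∈ C | lam ω s ≠ ∞}) hgen hpi
    (sep_subset _ _) (hCc.mono (sep_subset _ _)) ?_ (fun s hs => hs.2) hω
  refine eq_univ_of_forall fun x => ?_
  obtain ⟨V, hV, hVo, hVfin⟩ := (lam ω).exists_isOpen_measure_lt_top x
  obtain ⟨s, hs, hxs, hsV⟩ := hCb.exists_subset_of_mem_open hV hVo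
  exact ⟨s, ⟨hs, ((measure_mono hsV).trans_lt hVfin).ne⟩, hxs⟩

end Map

/-! ### Symmetry -/

section Symmetry

variable {Ω : Type*} [MeasurableSpace Ω] {P : Measure Ω}
  {G : Type*} [Group G] [MulAction G Ω]
  {M : Type*} [MetricSpace M] [SecondCountableTopology M] [MeasurableSpace M] [BorelSpace M]
  [MulAction G M] [IsIsometricSMul G M] {m : Measure M} {F : Set M} {lam μ : Kernel Ω M}

theorem IsRandomMeasure.map_homeomorph {X Y : Type*} [TopologicalSpace X] [MeasurableSpace X]
    [BorelSpace X] [TopologicalSpace Y] [MeasurableSpace Y] [BorelSpace Y] {κ : Kernel Ω X}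
    (hκ : IsRandomMeasure κ) (e : X ≃ₜ Y) : IsRandomMeasure (κ.map e) := by
  intro ω
  have := hκ ω
  refine ⟨fun y => ?_⟩
  obtain ⟨V, hV, hVo, hVfin⟩ := (κ ω).exists_isOpen_measure_lt_top (e.symm y)
  refine ⟨e.symm ⁻¹' V, (hVo.preimage e.symm.continuous).mem_nhds hV, ?_⟩
  rw [Kernel.map_apply _ e.measurable, Measure.map_apply e.measurable
    (hVo.preimage e.symm.continuous).measurableSet, ← preimage_comp]
  simpa using hVfin

theorem IsEquivariantSemicoupling.swap {q : Kernel Ω (M × M)}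
    (hq : IsEquivariantSemicoupling G P q lam μ)
    (hq' : ∀ᵐ ω ∂P, IsCoupling (q ω) (lam ω) (μ ω)) :
    IsEquivariantSemicoupling G P (q.map Prod.swap) μ lam where
  isRandomMeasure := hq.isRandomMeasure.map_homeomorph (Homeomorph.prodComm M M)
  isEquivariant := hq.isEquivariant.map measurable_swap fun _ _ => rfl
  isSemicoupling := by
    filter_upwards [hq'] with ω hω
    rw [Kernel.map_apply _ measurable_swap]
    refine ⟨?_, ?_⟩
    · rw [Measure.map_map measurable_fst measurable_swap, ← hω.2]
      exact le_rfl
    · rw [Measure.map_map measurable_snd measurable_swap, ← hω.1]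
      rfl

variable [Countable G] [MeasurableConstSMul G Ω] [SMulInvariantMeasure G Ω P]

/-- Exchanging the factors moves the localisation to the other coordinate, which mass transport
undoes. -/
theorem meanCost_swap {q : Kernel Ω (M × M)} (hq : IsEquivariant G q)
    (hF : IsFundamentalRegion G F)
    (hm : ∀ F' : Set M, IsFundamentalRegion G F' → m F' = m F) (p : ℝ) :
    meanCost G P m p (q.map Prod.swap) = meanCost G P m p q := by
  rw [meanCost_eq (hq.map measurable_swap fun _ _ => rfl) hF hm, meanCost_eq hq hF hm,
    ← hq.mass_transport measurable_fst measurable_snd (fun _ _ => rfl) (fun _ _ => rfl)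
      (by fun_prop) (edist_rpow_smul p) hF hF]
  congr 2
  ext ω
  rw [Kernel.map_apply _ measurable_swap, setLIntegral_map (measurable_snd hF.measurableSet)
    (by fun_prop) measurable_swap]
  simp_rw [Prod.fst_swap, Prod.snd_swap, edist_comm]
  rfl

theorem wassersteinW_le_swap (hlam : IsEquivariant G lam) (hlam_unit : HasUnitIntensity P m lam)
    (hμ_unit : HasUnitIntensity P m μ) (hF : IsFundamentalRegion G F) (hmF : m F ≠ ∞)
    {p : ℝ} (hp : 0 ≤ p) :
    wassersteinW G P m p μ lam ≤ wassersteinW G P m p lam μ := by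
  refine ENNReal.rpow_le_rpow (le_iInf₂ fun q hq => ?_) (by positivity)
  refine iInf₂_le_of_le (q.map Prod.swap)
    (hq.swap (hq.ae_isCoupling hlam hlam_unit hμ_unit hF hmF)) ?_
  exact (meanCost_swap hq.isEquivariant hF
    (fun F' hF' => hlam_unit.measure_fundamentalRegion_eq hlam hF' hF) p).le

end Symmetry

/-! ### Vanishing distance -/

section Zero

variable {Ω : Type*} [MeasurableSpace Ω] {P : Measure Ω}
  {G : Type*} [Group G] [MulAction G Ω]
  {M : Type*} [MetricSpace M] [SecondCountableTopology M] [MeasurableSpace M] [BorelSpace M]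
  [MulAction G M] [IsIsometricSMul G M] {m : Measure M} {F : Set M} {lam μ : Kernel Ω M}

theorem isEquivariantSemicoupling_diagonal (hlam : IsRandomMeasure lam)
    (hlam_equiv : IsEquivariant G lam) (h : ∀ᵐ ω ∂P, lam ω = μ ω) :
    IsEquivariantSemicoupling G P (lam.map fun x => (x, x)) lam μ where
  isRandomMeasure := by
    intro ω
    have := hlam ω
    refine ⟨fun z => ?_⟩
    obtain ⟨V, hV, hVo, hVfin⟩ := (lam ω).exists_isOpen_measure_lt_top z.1
    have hVo' := hVo.preimage (continuous_fst (X := M) (Y := M))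
    refine ⟨Prod.fst ⁻¹' V, hVo'.mem_nhds hV, ?_⟩
    rwa [Kernel.map_apply _ (by fun_prop), Measure.map_apply (by fun_prop) hVo'.measurableSet]
  isEquivariant := hlam_equiv.map (by fun_prop) fun _ _ => rfl
  isSemicoupling := by
    filter_upwards [h] with ω hω
    rw [Kernel.map_apply _ (by fun_prop)]
    refine ⟨?_, ?_⟩
    · rw [Measure.map_map measurable_fst (by fun_prop)]
      exact Measure.map_id.le
    · rw [Measure.map_map measurable_snd (by fun_prop), ← hω]
      exact Measure.map_id

theorem wassersteinW_eq_zero_of_ae_eq (hlam : IsRandomMeasure lam)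
    (hlam_equiv : IsEquivariant G lam) (h : ∀ᵐ ω ∂P, lam ω = μ ω) {p : ℝ} (hp : 0 < p) :
    wassersteinW G P m p lam μ = 0 := by
  rw [wassersteinW, ENNReal.rpow_eq_zero_iff_of_pos (by positivity)]
  refine le_antisymm (iInf₂_le_of_le _
    (isEquivariantSemicoupling_diagonal hlam hlam_equiv h) ?_) zero_le
  refine iSup₂_le fun B _ => ?_
  have h0 : ∀ ω, ∫⁻ z in univ ×ˢ B, edist z.1 z.2 ^ p ∂(lam.map (fun x => (x, x)) ω) = 0 := by
    intro ω
    refine le_antisymm ((setLIntegral_le_lintegral _ _).trans ?_) zero_le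
    rw [Kernel.map_apply _ (by fun_prop), lintegral_map (by fun_prop) (by fun_prop)]
    simp [hp]
  simp [h0]

variable [Countable G] [MeasurableConstSMul G Ω] [SMulInvariantMeasure G Ω P]

/-- Markov's inequality on each of the finitely many regions indexed by `J`; mass transport then
replaces localisation of the first coordinate there by localisation of the second in `F`. -/
theorem IsEquivariant.lintegral_le_of_edist_ge {q : Kernel Ω (M × M)} (hq : IsEquivariant G q)
    (hF : IsFundamentalRegion G F) {p : ℝ} (hp : 0 ≤ p) {ε : ℝ≥0∞} (hε : ε ≠ 0) (hε' : ε ≠ ∞)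
    (J : Finset G) :
    ∫⁻ ω, q ω {z | (∃ g ∈ J, g • z.1 ∈ F) ∧ ε ≤ edist z.1 z.2} ∂P
      ≤ J.card * ((ε ^ p)⁻¹ * ∫⁻ ω, ∫⁻ z in Prod.snd ⁻¹' F, edist z.1 z.2 ^ p ∂(q ω) ∂P) := by
  have hεp : ε ^ p ≠ 0 := by simp [hε, hε']
  have hεp' : ε ^ p ≠ ∞ := ENNReal.rpow_ne_top_of_nonneg hp hε'
  have hmeas : MeasurableSet {z : M × M | ε ^ p ≤ edist z.1 z.2 ^ p} :=
    measurableSet_le measurable_const (by fun_prop)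
  calc ∫⁻ ω, q ω {z | (∃ g ∈ J, g • z.1 ∈ F) ∧ ε ≤ edist z.1 z.2} ∂P
      ≤ ∫⁻ ω, ∑ g ∈ J, (ε ^ p)⁻¹ *
          ∫⁻ z in Prod.fst ⁻¹' ((fun x => g • x) ⁻¹' F), edist z.1 z.2 ^ p ∂(q ω) ∂P := by
        refine lintegral_mono fun ω => ?_
        refine (measure_mono (t := ⋃ g ∈ J, Prod.fst ⁻¹' ((fun x => g • x) ⁻¹' F) ∩
          {z : M × M | ε ^ p ≤ edist z.1 z.2 ^ p}) ?_).trans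
          ((measure_biUnion_finset_le _ _).trans (Finset.sum_le_sum fun g _ => ?_))
        · rintro z ⟨⟨g, hg, hz⟩, hz'⟩
          exact mem_iUnion₂.2 ⟨g, hg, hz, ENNReal.rpow_le_rpow hz' hp⟩
        · rw [← ENNReal.mul_le_iff_le_inv hεp hεp', inter_comm,
            ← Measure.restrict_apply hmeas]
          exact mul_meas_ge_le_lintegral (by fun_prop) _
    _ = _ := by
        have hm : ∀ g : G, Measurable fun ω =>
            ∫⁻ z in Prod.fst ⁻¹' ((fun x => g • x) ⁻¹' F), edist z.1 z.2 ^ p ∂(q ω) := fun g =>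
          measurable_setLIntegral_kernel q (by fun_prop)
            (measurable_fst (hF.smul_preimage g).measurableSet)
        rw [lintegral_finsetSum _ fun g _ => (hm g).const_mul _]
        rw [Finset.sum_congr rfl fun g _ => (lintegral_const_mul _ (hm g)).trans
          (congrArg _ (hq.mass_transport measurable_fst measurable_snd (fun _ _ => rfl)
            (fun _ _ => rfl) (by fun_prop) (edist_rpow_smul p) (hF.smul_preimage g) hF))]
        simp

/-- If the transportation cost vanishes, the mass of a set is at most that of its
`ε`-neighbourhood. -/
theorem ae_le_thickening_of_wassersteinW_eq_zero (hlam : IsEquivariant G lam)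
    (hlam_unit : HasUnitIntensity P m lam) (hμ_unit : HasUnitIntensity P m μ)
    (hF : IsFundamentalRegion G F) (hmF : m F ≠ ∞) {p : ℝ} (hp : 0 < p)
    (hW : wassersteinW G P m p lam μ = 0) {A : Set M} (hA : MeasurableSet A) {ε : ℝ}
    (hε : 0 < ε) : ∀ᵐ ω ∂P, lam ω A ≤ μ ω (Metric.thickening ε A) := by
  have hT : ∀ J : Finset G, MeasurableSet {x : M | ∃ g ∈ J, g • x ∈ F} := by
    intro J
    have : {x : M | ∃ g ∈ J, g • x ∈ F} = ⋃ g ∈ J, (fun x => g • x) ⁻¹' F := by ext; simp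
    rw [this]
    exact J.measurableSet_biUnion fun g _ => (hF.smul_preimage g).measurableSet
  have hthick : MeasurableSet (Metric.thickening ε A) := Metric.isOpen_thickening.measurableSet
  have hε0 : ENNReal.ofReal ε ≠ 0 := by simpa using hε
  have hεp : (ENNReal.ofReal ε ^ p)⁻¹ ≠ ∞ := by simp [hε0]
  -- Cutting `A` down to finitely many translates makes the bound proportional to the cost with a
  -- finite factor; the cut is removed at the end by monotone convergence.
  have hJ : ∀ J : Finset G, ∀ᵐ ω ∂P,
      lam ω (A ∩ {x | ∃ g ∈ J, g • x ∈ F}) ≤ μ ω (Metric.thickening ε A) := by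
    intro J
    have hmeas : Measurable fun ω =>
        lam ω (A ∩ {x | ∃ g ∈ J, g • x ∈ F}) - μ ω (Metric.thickening ε A) :=
      (lam.measurable_coe (hA.inter (hT J))).sub (μ.measurable_coe hthick)
    have hle : ∀ q, IsEquivariantSemicoupling G P q lam μ →
        ∫⁻ ω, lam ω (A ∩ {x | ∃ g ∈ J, g • x ∈ F}) - μ ω (Metric.thickening ε A) ∂P
          ≤ J.card * ((ENNReal.ofReal ε ^ p)⁻¹ *
            ∫⁻ ω, ∫⁻ z in Prod.snd ⁻¹' F, edist z.1 z.2 ^ p ∂(q ω) ∂P) := by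
      intro q hq
      refine le_trans (lintegral_mono_ae ?_)
        (hq.isEquivariant.lintegral_le_of_edist_ge hF hp.le hε0 ENNReal.ofReal_ne_top J)
      filter_upwards [hq.ae_isCoupling hlam hlam_unit hμ_unit hF hmF] with ω hω
      rw [tsub_le_iff_left, ← hω.1, ← hω.2, Measure.map_apply measurable_fst (hA.inter (hT J)),
        Measure.map_apply measurable_snd hthick]
      refine (measure_mono ?_).trans (measure_union_le _ _)
      rintro z ⟨hzA, hzJ⟩
      by_cases hz : z.2 ∈ Metric.thickening ε A
      · exact Or.inl hz
      · refine Or.inr ⟨hzJ, ?_⟩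
        rw [Metric.mem_thickening_iff] at hz
        push Not at hz
        rw [edist_dist]
        exact ENNReal.ofReal_le_ofReal (by rw [dist_comm]; exact hz _ hzA)
    have hzero : ∫⁻ ω, lam ω (A ∩ {x | ∃ g ∈ J, g • x ∈ F}) - μ ω (Metric.thickening ε A) ∂P
        = 0 := by
      by_contra hne
      set c := ∫⁻ ω, lam ω (A ∩ {x | ∃ g ∈ J, g • x ∈ F}) - μ ω (Metric.thickening ε A) ∂P
        with hc
      rw [wassersteinW, ENNReal.rpow_eq_zero_iff_of_pos (by positivity)] at hW
      -- The threshold `(m F)⁻¹ * (c * D⁻¹)` is positive as `m F` and `D` are finite. The infimum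
      -- being zero, some semicoupling costs less, which contradicts `hle`.
      set D : ℝ≥0∞ := J.card * (ENNReal.ofReal ε ^ p)⁻¹ with hD
      have hD' : D ≠ ∞ := ENNReal.mul_ne_top (ENNReal.natCast_ne_top _) hεp
      have hpos : 0 < (m F)⁻¹ * (c * D⁻¹) := by
        refine pos_iff_ne_zero.2 (mul_ne_zero (by simpa using hmF) (mul_ne_zero hne ?_))
        simpa using hD'
      rw [← hW] at hpos
      obtain ⟨q, hq, hlt⟩ := by simpa only [iInf_lt_iff] using hpos
      rw [meanCost_eq hq.isEquivariant hF
        (fun F' hF' => hlam_unit.measure_fundamentalRegion_eq hlam hF' hF)] at hlt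
      have h1 := lt_of_mul_lt_mul_left' hlt
      have h2 := hle q hq
      rw [← mul_assoc, mul_comm] at h2
      exact absurd h2 (not_le.2 (ENNReal.mul_lt_of_lt_div h1))
    filter_upwards [(lintegral_eq_zero_iff hmeas).1 hzero] with ω hω
    exact tsub_eq_zero_iff_le.1 hω
  filter_upwards [ae_all_iff.2 hJ] with ω hω
  have hU : A = ⋃ J : Finset G, A ∩ {x | ∃ g ∈ J, g • x ∈ F} := by
    refine Set.ext fun x => ⟨fun hx => ?_, fun hx => ?_⟩
    · obtain ⟨g, hg⟩ := hF.exists_smul_mem x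
      exact mem_iUnion.2 ⟨{g}, hx, g, by simp, hg⟩
    · exact (mem_iUnion.1 hx).choose_spec.1
  have hmono : Monotone fun J : Finset G => A ∩ {x | ∃ g ∈ J, g • x ∈ F} :=
    fun J J' h x hx => ⟨hx.1, hx.2.imp fun g hg => ⟨h hg.1, hg.2⟩⟩
  conv_lhs => rw [hU]
  rw [hmono.directed_le.measure_iUnion]
  exact iSup_le hω

/-- The points at distance at least `1 / (n + 1)` from the complement exhaust `U`, and their
thickenings by that radius stay inside `U`. -/
theorem ae_le_of_isOpen_of_wassersteinW_eq_zero (hlam : IsEquivariant G lam)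
    (hlam_unit : HasUnitIntensity P m lam) (hμ_unit : HasUnitIntensity P m μ)
    (hF : IsFundamentalRegion G F) (hmF : m F ≠ ∞) {p : ℝ} (hp : 0 < p)
    (hW : wassersteinW G P m p lam μ = 0) {U : Set M} (hU : IsOpen U) :
    ∀ᵐ ω ∂P, lam ω U ≤ μ ω U := by
  set A : ℕ → Set M := fun n => {x | ENNReal.ofReal (1 / ((n : ℝ) + 1)) ≤ Metric.infEDist x Uᶜ} with hA
  have hAm : ∀ n, MeasurableSet (A n) := fun n =>
    (isClosed_le continuous_const Metric.continuous_infEDist).measurableSet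
  have hAU : ∀ n : ℕ, Metric.thickening (1 / ((n : ℝ) + 1)) (A n) ⊆ U := by
    intro n y hy
    obtain ⟨z, hz, hyz⟩ := Metric.mem_thickening_iff.1 hy
    by_contra hyU
    have h1 : Metric.infEDist z Uᶜ ≤ edist z y := Metric.infEDist_le_edist_of_mem hyU
    have h2 : edist z y < ENNReal.ofReal (1 / ((n : ℝ) + 1)) := by
      rw [edist_comm, edist_dist]
      exact (ENNReal.ofReal_lt_ofReal_iff (by positivity)).2 hyz
    exact absurd (hz.trans h1) (not_le.2 h2)
  have hmono : Monotone A := by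
    intro a b hab x hx
    refine le_trans (ENNReal.ofReal_le_ofReal ?_) hx
    exact one_div_le_one_div_of_le (by positivity) (by gcongr)
  have hAU' : U ⊆ ⋃ n, A n := by
    intro x hx
    have h1 : 0 < Metric.infEDist x Uᶜ := by
      rw [pos_iff_ne_zero]
      intro h0
      have := (Metric.mem_closure_iff_infEDist_zero.2 h0)
      rw [hU.isClosed_compl.closure_eq] at this
      exact this hx
    obtain ⟨r, hr0, hr⟩ := ENNReal.lt_iff_exists_nnreal_btwn.1 h1
    obtain ⟨n, hn⟩ := exists_nat_one_div_lt (show (0 : ℝ) < r by exact_mod_cast hr0)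
    refine mem_iUnion.2 ⟨n, le_trans (ENNReal.ofReal_le_ofReal hn.le) ?_⟩
    rw [ENNReal.ofReal_coe_nnreal]
    exact hr.le
  have hae : ∀ᵐ ω ∂P, ∀ n : ℕ, lam ω (A n) ≤ μ ω (Metric.thickening (1 / ((n : ℝ) + 1)) (A n)) :=
    ae_all_iff.2 fun n => ae_le_thickening_of_wassersteinW_eq_zero hlam hlam_unit hμ_unit hF hmF
      hp hW (hAm n) (by positivity)
  filter_upwards [hae] with ω hω
  refine (measure_mono hAU').trans ?_
  rw [hmono.measure_iUnion]
  exact iSup_le fun n => (hω n).trans (measure_mono (hAU n))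

theorem ae_eq_of_wassersteinW_eq_zero (hlam_rm : IsRandomMeasure lam)
    (hlam : IsEquivariant G lam) (hlam_unit : HasUnitIntensity P m lam)
    (hμ : IsEquivariant G μ) (hμ_unit : HasUnitIntensity P m μ)
    (hF : IsFundamentalRegion G F) (hmF : m F ≠ ∞) {p : ℝ} (hp : 0 < p)
    (hW : wassersteinW G P m p lam μ = 0) : ∀ᵐ ω ∂P, lam ω = μ ω := by
  have hW' : wassersteinW G P m p μ lam = 0 := le_antisymm
    ((wassersteinW_le_swap hlam hlam_unit hμ_unit hF hmF hp.le).trans hW.le) zero_le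
  refine hlam_rm.ae_eq_of_forall_isOpen fun U hU => ?_
  filter_upwards [ae_le_of_isOpen_of_wassersteinW_eq_zero hlam hlam_unit hμ_unit hF hmF hp hW hU,
    ae_le_of_isOpen_of_wassersteinW_eq_zero hμ hμ_unit hlam_unit hF hmF hp hW' hU] with ω h1 h2
  exact le_antisymm h1 h2

end Zero

/-! ### S-finiteness and disintegration of kernels -/

section Normalize

variable {α β : Type*} [MeasurableSpace α] [MeasurableSpace β]

/-- Each value of a kernel divided by its total mass. -/
noncomputable def ProbabilityTheory.Kernel.normalize (κ : Kernel α β) : Kernel α β where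
  toFun a := (κ a univ)⁻¹ • κ a
  measurable' := by
    refine Measure.measurable_of_measurable_coe _ fun s hs => ?_
    exact (κ.measurable_coe MeasurableSet.univ).inv.mul (κ.measurable_coe hs)

theorem ProbabilityTheory.Kernel.normalize_apply (κ : Kernel α β) (a : α) :
    κ.normalize a = (κ a univ)⁻¹ • κ a := rfl

instance (κ : Kernel α β) : IsFiniteKernel κ.normalize :=
  ⟨1, ENNReal.one_lt_top, fun a => by
    rw [Kernel.normalize_apply, Measure.smul_apply, smul_eq_mul]
    exact ENNReal.inv_mul_le_one _⟩

theorem ProbabilityTheory.Kernel.measure_univ_smul_normalize (κ : Kernel α β) {a : α}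
    (ha : κ a univ ≠ ∞) : κ a univ • κ.normalize a = κ a := by
  by_cases h0 : κ a univ = 0
  · rw [h0, zero_smul, Measure.measure_univ_eq_zero.1 h0]
  · rw [Kernel.normalize_apply, smul_smul, ENNReal.mul_inv_cancel h0 ha, one_smul]

/-- The masses need not be uniformly bounded, so the kernel is written as its normalisation with the
total mass as a finite density. -/
theorem isSFiniteKernel_of_measure_univ_ne_top {κ : Kernel α β} (h : ∀ a, κ a univ ≠ ∞) :
    IsSFiniteKernel κ := by
  have hm : Measurable (Function.uncurry fun (a : α) (_ : β) => κ a univ) :=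
    (κ.measurable_coe MeasurableSet.univ).comp measurable_fst
  have : κ = κ.normalize.withDensity fun a _ => κ a univ := by
    ext a : 1
    rw [Kernel.withDensity_apply _ hm, withDensity_const, κ.measure_univ_smul_normalize (h a)]
  rw [this]
  exact Kernel.IsSFiniteKernel.withDensity _ fun a _ => h a

theorem isSFiniteKernel_of_countable_partition {ι : Type*} [Countable ι] {κ : Kernel α β}
    {S : ι → Set β} (hS : ∀ i, MeasurableSet (S i)) (hd : Pairwise (Function.onFun Disjoint S))
    (hU : ⋃ i, S i = univ) (h : ∀ a i, κ a (S i) ≠ ∞) : IsSFiniteKernel κ := by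
  have h1 : κ = Kernel.sum fun i => κ.restrict (hS i) := by
    ext a : 1
    simp_rw [Kernel.sum_apply, Kernel.restrict_apply]
    rw [← Measure.restrict_iUnion hd hS, hU, Measure.restrict_univ]
  rw [h1]
  have h2 : ∀ i, IsSFiniteKernel (κ.restrict (hS i)) := fun i =>
    isSFiniteKernel_of_measure_univ_ne_top fun a => by
      rw [Kernel.restrict_apply, Measure.restrict_apply_univ]
      exact h a i
  exact Kernel.isSFiniteKernel_sum

theorem measurable_of_countable_selection {ι : Type*} [Countable ι] {f : ι → α → β}
    (hf : ∀ i, Measurable (f i)) {s : α → ι} (hs : ∀ i, MeasurableSet {a | s a = i}) :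
    Measurable fun a => f (s a) a := by
  intro B hB
  have : (fun a => f (s a) a) ⁻¹' B = ⋃ i, {a | s a = i} ∩ f i ⁻¹' B := by
    ext a; simp
  rw [this]
  exact MeasurableSet.iUnion fun i => (hs i).inter (hf i hB)

/-- Disintegration of a kernel on the part of the first factor where it is finite. -/
theorem exists_condKernel_restrict {γ : Type*} [MeasurableSpace γ] [StandardBorelSpace γ]
    [Nonempty γ] [MeasurableSpace.CountablyGenerated β] (q : Kernel α (β × γ)) {F : Set β}
    (hF : MeasurableSet F) :
    ∃ K : Kernel (α × β) γ, IsMarkovKernel K ∧ ∀ a, q a (Prod.fst ⁻¹' F) ≠ ∞ →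
      ∀ f : β × γ → ℝ≥0∞, Measurable f → ∫⁻ z in Prod.fst ⁻¹' F, f z ∂q a
        = ∫⁻ z in Prod.fst ⁻¹' F, ∫⁻ w, f (z.1, w) ∂K (a, z.1) ∂q a := by
  -- Some values may have infinite mass even on this part. Normalising gives a finite kernel
  -- everywhere, to which conditional kernels apply; where the mass is finite, the scalar is
  -- restored.
  set κ := q.restrict (measurable_fst hF : MeasurableSet (Prod.fst ⁻¹' F)) with hκ
  refine ⟨κ.normalize.condKernel, inferInstance, fun a ha f hf => ?_⟩
  have hκa : κ a = (q a).restrict (Prod.fst ⁻¹' F) := Kernel.restrict_apply _ _ _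
  have hfin : κ a univ ≠ ∞ := by rwa [hκa, Measure.restrict_apply_univ]
  have h1 : ∫⁻ z, f z ∂κ.normalize a
      = ∫⁻ z, ∫⁻ w, f (z.1, w) ∂κ.normalize.condKernel (a, z.1) ∂κ.normalize a := by
    conv_lhs => rw [← Kernel.disintegrate κ.normalize κ.normalize.condKernel]
    rw [Kernel.lintegral_compProd _ _ _ hf, Kernel.fst_apply, lintegral_map ?_ measurable_fst]
    exact Measurable.lintegral_kernel_prod_right'
      (κ := κ.normalize.condKernel.comap (fun b => (a, b)) measurable_prodMk_left) hf
  rw [← hκa, ← κ.measure_univ_smul_normalize hfin, lintegral_smul_measure,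
    lintegral_smul_measure, h1]

end Normalize

/-! ### Equivariant disintegration -/

section Gluing

variable {Ω : Type*} [MeasurableSpace Ω]
  {G : Type*} [Group G] [Countable G] [MulAction G Ω] [MeasurableConstSMul G Ω]
  {M : Type*} [MeasurableSpace M] [MulAction G M] [MeasurableConstSMul G M] {F : Set M}

/-- An equivariant random measure on a product has an equivariant disintegration with respect
to its first marginal. -/
theorem IsEquivariant.exists_condKernel [StandardBorelSpace M] [Nonempty M]
    [MeasurableConstSMul G (M × M)] {q : Kernel Ω (M × M)} (hq : IsEquivariant G q)
    (hF : IsFundamentalRegion G F) :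
    ∃ K : Kernel (Ω × M) M, IsMarkovKernel K ∧
      (∀ (g : G) ω y, (K (ω, y)).map (g • ·) = K (g • ω, g • y)) ∧
      ∀ ω, (∀ g : G, q (g • ω) (Prod.fst ⁻¹' F) ≠ ∞) → ∀ f : M × M → ℝ≥0∞, Measurable f →
        ∫⁻ z, f z ∂q ω = ∫⁻ z, ∫⁻ w, f (z.1, w) ∂K (ω, z.1) ∂q ω := by
  obtain ⟨K₀, hK₀, hdis⟩ := exists_condKernel_restrict q hF.measurableSet
  -- `s x` is the unique element moving `x` into `F`. The kernel `K` moves the base point there,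
  -- disintegrates, and moves back; the cocycle rule `hs_smul` makes this equivariant.
  choose s hs using hF.exists_smul_mem
  have hs_eq : ∀ {g : G} {x : M}, g • x ∈ F → s x = g := fun {g x} hg =>
    hF.eq_of_smul_mem (hs x) hg
  have hs_iff : ∀ (g : G) (x : M), s x = g ↔ g • x ∈ F := fun g x =>
    ⟨fun h => h ▸ hs x, hs_eq⟩
  have hs_smul : ∀ (g : G) (x : M), s (g • x) = s x * g⁻¹ := fun g x =>
    hs_eq (by rw [smul_smul, inv_mul_cancel_right]; exact hs x)
  have hact : ∀ g : G, Measurable fun a : Ω × M => (g • a.1, g • a.2) := fun g =>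
    (measurable_fst.const_smul g).prodMk (measurable_snd.const_smul g)
  let K : Kernel (Ω × M) M :=
    { toFun := fun a => (K₀ (s a.2 • a.1, s a.2 • a.2)).map ((s a.2)⁻¹ • ·)
      measurable' := by
        refine measurable_of_countable_selection (ι := G)
          (f := fun g (a : Ω × M) => (K₀ (g • a.1, g • a.2)).map (g⁻¹ • ·)) (s := fun a : Ω × M => s a.2) ?_ ?_
        · intro g
          exact (Measure.measurable_map _ (measurable_const_smul _)).comp
            (K₀.measurable.comp (hact g))
        · intro g
          simp_rw [hs_iff]
          exact hF.measurableSet_smul_preimage measurable_snd g }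
  have hK : ∀ ω y, K (ω, y) = (K₀ (s y • ω, s y • y)).map ((s y)⁻¹ • ·) := fun _ _ => rfl
  refine ⟨K, ⟨fun a => ?_⟩, ?_, ?_⟩
  · rw [hK]
    exact Measure.isProbabilityMeasure_map (measurable_const_smul _).aemeasurable
  · intro g ω y
    rw [hK, hK, Measure.map_map (measurable_const_smul _) (measurable_const_smul _), hs_smul,
      smul_smul, smul_smul, inv_mul_cancel_right]
    congr 1
    ext w
    simp [smul_smul]
  · intro ω hω f hf
    rw [hF.lintegral_eq_tsum measurable_fst, hF.lintegral_eq_tsum measurable_fst (q ω)]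
    refine tsum_congr fun g => ?_
    have hshift : ∀ h : M × M → ℝ≥0∞, Measurable h →
        ∫⁻ z in (fun z : M × M => g • z.1) ⁻¹' F, h (g • z) ∂q ω
          = ∫⁻ z in Prod.fst ⁻¹' F, h z ∂q (g • ω) := by
      intro h hh
      rw [← hq.map_smul, setLIntegral_map (measurable_fst hF.measurableSet) hh
        (measurable_const_smul g)]
      rfl
    have hfg : Measurable fun z => f (g⁻¹ • z) := hf.comp (measurable_const_smul _)
    have h1 := hshift _ hfg
    simp only [inv_smul_smul] at h1
    rw [h1, hdis _ (hω g) _ hfg, ← hshift]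
    · refine setLIntegral_congr_fun (hF.measurableSet_smul_preimage measurable_fst g) fun z hz => ?_
      have hsz : s z.1 = g := hs_eq hz
      change ∫⁻ w, f (g⁻¹ • (g • z.1, w)) ∂K₀ (g • ω, g • z.1) = ∫⁻ w, f (z.1, w) ∂K (ω, z.1)
      have hfz : Measurable fun w => f (z.1, w) := hf.comp measurable_prodMk_left
      rw [hK, hsz, lintegral_map hfz (measurable_const_smul _)]
      refine lintegral_congr fun w => ?_
      simp
    · exact (Measurable.lintegral_kernel_prod_right'
        (κ := K₀.comap (fun b => (g • ω, b)) measurable_prodMk_left)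
        hfg).comp measurable_fst

end Gluing

theorem IsRandomMeasure.measure_ne_top_of_isCompact_closure {Ω X : Type*}
    [MeasurableSpace Ω] [TopologicalSpace X]
    [MeasurableSpace X] {κ : Kernel Ω X} (hκ : IsRandomMeasure κ) {U : Set X}
    (hU : IsCompact (closure U)) (ω : Ω) : κ ω U ≠ ∞ := by
  have := hκ ω
  exact ((measure_mono subset_closure).trans_lt hU.measure_lt_top).ne

/-! ### Composition and restriction of equivariant kernels -/

section Kernels

variable {Ω : Type*} [MeasurableSpace Ω] {G : Type*} [Group G] [MulAction G Ω]

theorem isEquivariant_compProd {X Y : Type*} [MeasurableSpace X] [MulAction G X]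
    [MeasurableConstSMul G X] [MeasurableSpace Y] [MulAction G Y] [MeasurableConstSMul G Y]
    [MeasurableConstSMul G (X × Y)] {κ : Kernel Ω X} [IsSFiniteKernel κ] (hκ : IsEquivariant G κ)
    {η : Kernel (Ω × X) Y} [IsSFiniteKernel η]
    (hη : ∀ (g : G) ω x, (η (ω, x)).map (g • ·) = η (g • ω, g • x)) :
    IsEquivariant G (κ ⊗ₖ η) := by
  refine isEquivariant_of_map_smul fun g ω => Measure.ext_of_lintegral _ fun f hf => ?_
  have hfg : Measurable fun t => f (g • t) := hf.comp (measurable_const_smul g)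
  rw [lintegral_map hf (measurable_const_smul g), Kernel.lintegral_compProd _ _ _ hf,
    Kernel.lintegral_compProd _ _ _ hfg, hκ.lintegral_smul]
  · refine lintegral_congr fun x => ?_
    have hfx : Measurable fun y => f (g • x, y) := hf.comp measurable_prodMk_left
    rw [← hη, lintegral_map hfx (measurable_const_smul g)]
    rfl
  · exact Measurable.lintegral_kernel_prod_right'
      (κ := η.comap (fun b => (g • ω, b)) measurable_prodMk_left) hf

/-- The root is an order isomorphism of `[0, ∞]`, so it commutes with the infimum. -/
theorem wassersteinW_eq_iInf {M : Type*} [MetricSpace M] [MeasurableSpace M] [MulAction G M]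
    (P : Measure Ω) (m : Measure M) {p : ℝ} (hp : 0 < p)
    (κ η : Kernel Ω M) :
    wassersteinW G P m p κ η
      = ⨅ q : {q // IsEquivariantSemicoupling G P q κ η}, meanCost G P m p q.1 ^ (1 / p) := by
  rw [wassersteinW, iInf_subtype']
  exact (ENNReal.orderIsoRpow (1 / p) (one_div_pos.2 hp)).map_iInf _

variable [Countable G] [MeasurableConstSMul G Ω]

/-- The part of an equivariant random measure which lives on the invariant event that all
translates of a cylinder set have finite mass. -/
theorem IsEquivariant.exists_restrict_finite {M : Type*} [MeasurableSpace M]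
    [MulAction G M] [MeasurableConstSMul G M] [MeasurableConstSMul G (M × M)]
    {q : Kernel Ω (M × M)} (hq : IsEquivariant G q)
    {U : Set M} (hU : MeasurableSet U) :
    ∃ q' : Kernel Ω (M × M), IsEquivariant G q' ∧ (∀ ω, q' ω (Prod.fst ⁻¹' U) ≠ ∞) ∧
      ∀ ω, (∀ g : G, q (g • ω) (Prod.fst ⁻¹' U) ≠ ∞) → q' ω = q ω := by
  classical
  have hΩ : MeasurableSet {ω : Ω | ∀ g : G, q (g • ω) (Prod.fst ⁻¹' U) ≠ ∞} := by
    rw [ofPred_forall]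
    refine MeasurableSet.iInter fun g => ?_
    exact ((q.measurable_coe (measurable_fst hU)).comp (measurable_const_smul g))
      (measurableSet_singleton ∞).compl
  have hinv : ∀ (h : G) (ω : Ω), (∀ g : G, q (g • h • ω) (Prod.fst ⁻¹' U) ≠ ∞)
      ↔ ∀ g : G, q (g • ω) (Prod.fst ⁻¹' U) ≠ ∞ := fun h ω =>
    ⟨fun H g => by simpa [smul_smul] using H (g * h⁻¹),
      fun H g => by simpa [smul_smul] using H (g * h)⟩
  refine ⟨Kernel.piecewise hΩ q 0, ?_, ?_, ?_⟩
  · intro g ω A hA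
    rw [Kernel.piecewise_apply, Kernel.piecewise_apply]
    simp only [mem_ofPred_eq, hinv]
    split_ifs
    · exact hq g ω A hA
    · simp
  · intro ω
    rw [Kernel.piecewise_apply]
    split_ifs with h
    · simpa using h 1
    · simp
  · intro ω h
    rw [Kernel.piecewise_apply]
    exact if_pos h

end Kernels

/-! ### Gluing and the triangle inequality -/

section Triangle

variable {Ω : Type*} [MeasurableSpace Ω] {P : Measure Ω}
  {G : Type*} [Group G] [MulAction G Ω]
  {M : Type*} [MetricSpace M] [SecondCountableTopology M] [MeasurableSpace M] [BorelSpace M]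
  [MulAction G M] [IsIsometricSMul G M] {m : Measure M} {F : Set M} {lam μ ξ : Kernel Ω M}

/-- The marginal bound is known only for almost every `ω`; equivariance of both kernels carries it
along the whole orbit of such an `ω`. -/
theorem IsEquivariant.measure_preimage_smul_ne_top {q : Kernel Ω (M × M)}
    (hq : IsEquivariant G q) (hlam : IsEquivariant G lam) {φ : M × M → M} (hφ : Measurable φ)
    (hφG : ∀ (g : G) z, φ (g • z) = g • φ z) {ω : Ω} (hle : (q ω).map φ ≤ lam ω) {U : Set M}
    (hU : MeasurableSet U) (hlamU : ∀ ω, lam ω U ≠ ∞) (g : G) :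
    q (g • ω) (φ ⁻¹' U) ≠ ∞ := by
  have h1 : q (g • ω) (φ ⁻¹' U) = (q ω).map φ ((fun x => g • x) ⁻¹' U) := by
    rw [← hq.map_smul, Measure.map_apply (measurable_const_smul g) (hφ hU),
      Measure.map_apply hφ ((measurable_const_smul g) hU)]
    congr 1
    ext z
    simp [hφG]
  have h2 : lam ω ((fun x => g • x) ⁻¹' U) = lam (g • ω) U := by
    rw [← hlam.map_smul, Measure.map_apply (measurable_const_smul g) hU]
  rw [h1]
  exact ((hle _).trans_lt (h2 ▸ (hlamU _).lt_top)).ne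

theorem isRandomMeasure_of_fst_ne_top {q : Kernel Ω (M × M)} (hq : IsEquivariant G q)
    (hF : IsFundamentalRegion G F) {U : Set M} (hFU : F ⊆ U) (hU : IsOpen U)
    (hqU : ∀ ω, q ω (Prod.fst ⁻¹' U) ≠ ∞) : IsRandomMeasure q := by
  refine fun ω => ⟨fun z => ?_⟩
  obtain ⟨g, hg⟩ := hF.exists_smul_mem z.1
  refine ⟨(fun z : M × M => g • z.1) ⁻¹' U, (hU.preimage (by fun_prop)).mem_nhds (hFU hg), ?_⟩
  have := hqU (g • ω)
  rw [← hq.map_smul, Measure.map_apply (measurable_const_smul g)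
      (measurable_fst hU.measurableSet)] at this
  exact this.lt_top

variable [Countable G]

theorem IsEquivariant.isSFiniteKernel {q : Kernel Ω (M × M)} (hq : IsEquivariant G q)
    (hF : IsFundamentalRegion G F) (hqF : ∀ ω, q ω (Prod.fst ⁻¹' F) ≠ ∞) :
    IsSFiniteKernel q := by
  refine isSFiniteKernel_of_countable_partition (ι := G)
    (S := fun g => (fun z : M × M => g • z.1) ⁻¹' F)
    (hF.measurableSet_smul_preimage measurable_fst) ?_ ?_ ?_
  · exact fun g h hgh => Set.disjoint_left.2 fun x hg hh => hgh (hF.eq_of_smul_mem hg hh)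
  · exact eq_univ_of_forall fun z => mem_iUnion.2 (hF.exists_smul_mem z.1)
  · intro ω g
    have := hqF (g • ω)
    rwa [← hq.map_smul, Measure.map_apply (measurable_const_smul g)
      (measurable_fst hF.measurableSet)] at this

variable [MeasurableConstSMul G Ω]

/-- The gluing lemma for equivariant semicouplings. -/
theorem IsEquivariantSemicoupling.exists_glue [StandardBorelSpace M] [Nonempty M]
    (hlam_rm : IsRandomMeasure lam) (hlam : IsEquivariant G lam)
    (hξ_rm : IsRandomMeasure ξ) (hξ : IsEquivariant G ξ) {q₁ q₂ : Kernel Ω (M × M)}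
    (hq₁ : IsEquivariantSemicoupling G P q₁ lam ξ) (hq₂ : IsEquivariantSemicoupling G P q₂ ξ μ)
    (hq₂' : ∀ᵐ ω ∂P, IsCoupling (q₂ ω) (ξ ω) (μ ω))
    (hF : IsFundamentalRegion G F) {U : Set M} (hFU : F ⊆ U) (hU : IsOpen U)
    (hUc : IsCompact (closure U)) :
    ∃ Q : Kernel Ω ((M × M) × M), IsSFiniteKernel Q ∧ IsEquivariant G Q ∧
      IsEquivariantSemicoupling G P (Q.map fun t => (t.1.1, t.2)) lam μ ∧
      (∀ᵐ ω ∂P, (Q ω).map Prod.fst = q₁ ω) ∧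
      ∀ᵐ ω ∂P, (Q ω).map (fun t => (t.1.2, t.2)) = q₂ ω := by
  -- A cylinder over `U` need not be relatively compact, so local finiteness of `q₁` does not bound
  -- its mass. An almost surely equal kernel with finite cylinder mass for every `ω` is s-finite, as
  -- the composition product requires.
  obtain ⟨q, hq, hqU, hqq⟩ := hq₁.isEquivariant.exists_restrict_finite hU.measurableSet
  have hqF : ∀ ω, q ω (Prod.fst ⁻¹' F) ≠ ∞ := fun ω =>
    ((measure_mono (preimage_mono hFU)).trans_lt (hqU ω).lt_top).ne
  have hqs := hq.isSFiniteKernel hF hqF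
  obtain ⟨K, hKm, hKG, hK⟩ := hq₂.isEquivariant.exists_condKernel hF
  have hKmeas : Measurable fun a : Ω × (M × M) => (a.1, a.2.2) := by fun_prop
  -- The third point depends on the first two only through the second: the outer points are
  -- conditionally independent given the middle one.
  set η : Kernel (Ω × (M × M)) M := K.comap _ hKmeas with hη
  have hηa : ∀ ω z, η (ω, z) = K (ω, z.2) := fun ω z => Kernel.comap_apply _ _ _
  have hQ : IsEquivariant G (q ⊗ₖ η) := isEquivariant_compProd hq fun g ω z => by
    rw [hηa, hηa, hKG]; rfl
  have hqae : ∀ᵐ ω ∂P, q ω = q₁ ω := by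
    filter_upwards [hq₁.isSemicoupling] with ω hω
    exact hqq ω (hq₁.isEquivariant.measure_preimage_smul_ne_top hlam measurable_fst
      (fun _ _ => rfl) hω.1 hU.measurableSet (hlam_rm.measure_ne_top_of_isCompact_closure hUc))
  have hfst : ∀ ω, ((q ⊗ₖ η) ω).map Prod.fst = q ω := fun ω => by
    rw [← Kernel.fst_apply, Kernel.fst_compProd]
  -- The middle marginal is `ξ ω` on both sides; this is where `q₂` must be a coupling.
  have hsnd : ∀ᵐ ω ∂P, ((q ⊗ₖ η) ω).map (fun t => (t.1.2, t.2)) = q₂ ω := by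
    filter_upwards [hqae, hq₁.isSemicoupling, hq₂'] with ω h1 h2 h3
    refine Measure.ext_of_lintegral _ fun f hf => ?_
    have hinner : Measurable fun y => ∫⁻ w, f (y, w) ∂K (ω, y) :=
      Measurable.lintegral_kernel_prod_right'
        (κ := K.comap (fun b => (ω, b)) measurable_prodMk_left) hf
    rw [hK ω (fun g => hq₂.isEquivariant.measure_preimage_smul_ne_top hξ measurable_fst
      (fun _ _ => rfl) h3.1.le hF.measurableSet
      (fun ω => ((measure_mono hFU).trans_lt
        (hξ_rm.measure_ne_top_of_isCompact_closure hUc ω).lt_top).ne) g) f hf,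
      ← lintegral_map hinner measurable_fst, h3.1, ← h2.2, lintegral_map hinner measurable_snd,
      lintegral_map hf (by fun_prop), Kernel.lintegral_compProd _ _ _ (by fun_prop), h1]
    simp_rw [hηa]
  have hG : IsEquivariant G ((q ⊗ₖ η).map fun t => (t.1.1, t.2)) :=
    hQ.map (by fun_prop) fun _ _ => rfl
  refine ⟨q ⊗ₖ η, inferInstance, hQ, ⟨?_, hG, ?_⟩, ?_, hsnd⟩
  · refine isRandomMeasure_of_fst_ne_top hG hF hFU hU fun ω => ?_
    rw [Kernel.map_apply' _ (by fun_prop) _ (measurable_fst hU.measurableSet)]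
    have := hqU ω
    rw [← hfst, Measure.map_apply measurable_fst (measurable_fst hU.measurableSet)] at this
    exact this
  · filter_upwards [hqae, hsnd, hq₁.isSemicoupling, hq₂.isSemicoupling] with ω h1 h2 h3 h4
    rw [Kernel.map_apply _ (by fun_prop)]
    refine ⟨?_, ?_⟩
    · refine le_trans (le_of_eq ?_) h3.1
      rw [Measure.map_map measurable_fst (by fun_prop), ← h1, ← hfst ω,
        Measure.map_map measurable_fst measurable_fst]
      rfl
    · rw [Measure.map_map measurable_snd (by fun_prop), ← h4.2, ← h2,
        Measure.map_map measurable_snd (by fun_prop)]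
      rfl
  · filter_upwards [hqae] with ω h1
    rw [hfst, h1]

variable [SMulInvariantMeasure G Ω P] [SFinite P]

/-- Minkowski's inequality for the single measure `N` that combines `P` with `Q` restricted to last
coordinate in `F`. -/
theorem rpow_lintegral_edist_le {Q : Kernel Ω ((M × M) × M)} [IsSFiniteKernel Q]
    (hF : MeasurableSet F) {p : ℝ} (hp : 1 ≤ p) :
    (∫⁻ ω, ∫⁻ t in Prod.snd ⁻¹' F, edist t.1.1 t.2 ^ p ∂Q ω ∂P) ^ (1 / p)
      ≤ (∫⁻ ω, ∫⁻ t in Prod.snd ⁻¹' F, edist t.1.1 t.1.2 ^ p ∂Q ω ∂P) ^ (1 / p)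
        + (∫⁻ ω, ∫⁻ t in Prod.snd ⁻¹' F, edist t.1.2 t.2 ^ p ∂Q ω ∂P) ^ (1 / p) := by
  set N : Measure (Ω × ((M × M) × M)) :=
    P ⊗ₘ Q.restrict (measurable_snd hF : MeasurableSet (Prod.snd ⁻¹' F)) with hN
  have hNint : ∀ f : (M × M) × M → ℝ≥0∞, Measurable f →
      ∫⁻ ω, ∫⁻ t in Prod.snd ⁻¹' F, f t ∂Q ω ∂P = ∫⁻ a, f a.2 ∂N := by
    intro f hf
    rw [hN, Measure.lintegral_compProd (f := fun a => f a.2) (hf.comp measurable_snd)]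
    simp_rw [Kernel.restrict_apply]
  rw [hNint _ (by fun_prop), hNint _ (by fun_prop), hNint _ (by fun_prop)]
  refine le_trans ?_ (ENNReal.lintegral_Lp_add_le (μ := N)
    (f := fun a => edist a.2.1.1 a.2.1.2) (g := fun a => edist a.2.1.2 a.2.2)
    (by fun_prop) (by fun_prop) hp)
  refine ENNReal.rpow_le_rpow (lintegral_mono fun a => ?_) (by positivity)
  exact ENNReal.rpow_le_rpow (edist_triangle _ _ _) (by positivity)

theorem IsEquivariantSemicoupling.exists_rpow_meanCost_le [StandardBorelSpace M] [Nonempty M]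
    (hlam_rm : IsRandomMeasure lam) (hlam : IsEquivariant G lam)
    (hξ_rm : IsRandomMeasure ξ) (hξ : IsEquivariant G ξ) (hξ_unit : HasUnitIntensity P m ξ)
    (hμ_unit : HasUnitIntensity P m μ) {q₁ q₂ : Kernel Ω (M × M)}
    (hq₁ : IsEquivariantSemicoupling G P q₁ lam ξ) (hq₂ : IsEquivariantSemicoupling G P q₂ ξ μ)
    (hF : IsFundamentalRegion G F) (hmF : m F ≠ ∞) {U : Set M} (hFU : F ⊆ U) (hU : IsOpen U)
    (hUc : IsCompact (closure U)) {p : ℝ} (hp : 1 ≤ p) :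
    ∃ q₃, IsEquivariantSemicoupling G P q₃ lam μ ∧ meanCost G P m p q₃ ^ (1 / p)
      ≤ meanCost G P m p q₁ ^ (1 / p) + meanCost G P m p q₂ ^ (1 / p) := by
  obtain ⟨Q, hQs, hQ, hq₃, h1, h2⟩ := hq₁.exists_glue hlam_rm hlam hξ_rm hξ hq₂
    (hq₂.ae_isCoupling hξ hξ_unit hμ_unit hF hmF) hF hFU hU hUc
  refine ⟨_, hq₃, ?_⟩
  have hm : ∀ F' : Set M, IsFundamentalRegion G F' → m F' = m F := fun F' hF' =>
    hξ_unit.measure_fundamentalRegion_eq hξ hF' hF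
  have hFm := hF.measurableSet
  have hp0 : 0 ≤ 1 / p := by positivity
  rw [meanCost_eq hq₃.isEquivariant hF hm, meanCost_eq hq₁.isEquivariant hF hm,
    meanCost_eq hq₂.isEquivariant hF hm, ENNReal.mul_rpow_of_nonneg _ _ hp0,
    ENNReal.mul_rpow_of_nonneg _ _ hp0, ENNReal.mul_rpow_of_nonneg _ _ hp0, ← mul_add]
  refine mul_le_mul_right ?_ _
  -- The cost of `q₁` localises the middle point of `Q`; mass transport moves the localisation to
  -- the last point, where the other two costs already have it.
  have e₁ : ∫⁻ ω, ∫⁻ z in Prod.snd ⁻¹' F, edist z.1 z.2 ^ p ∂q₁ ω ∂P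
      = ∫⁻ ω, ∫⁻ t in Prod.snd ⁻¹' F, edist t.1.1 t.1.2 ^ p ∂Q ω ∂P := by
    rw [hQ.mass_transport (φ₁ := Prod.snd) (φ₂ := fun t => t.1.2) measurable_snd (by fun_prop)
      (fun _ _ => rfl) (fun _ _ => rfl) (by fun_prop) (fun g t => edist_rpow_smul p g t.1) hF hF]
    refine lintegral_congr_ae ?_
    filter_upwards [h1] with ω hω
    rw [← hω, setLIntegral_map (measurable_snd hFm) (by fun_prop) measurable_fst]
    rfl
  have e₂ : ∫⁻ ω, ∫⁻ z in Prod.snd ⁻¹' F, edist z.1 z.2 ^ p ∂q₂ ω ∂P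
      = ∫⁻ ω, ∫⁻ t in Prod.snd ⁻¹' F, edist t.1.2 t.2 ^ p ∂Q ω ∂P := by
    refine lintegral_congr_ae ?_
    filter_upwards [h2] with ω hω
    rw [← hω, setLIntegral_map (measurable_snd hFm) (by fun_prop) (by fun_prop)]
    rfl
  have e₃ : ∫⁻ ω, ∫⁻ z in Prod.snd ⁻¹' F, edist z.1 z.2 ^ p
        ∂(Q.map fun t => (t.1.1, t.2)) ω ∂P
      = ∫⁻ ω, ∫⁻ t in Prod.snd ⁻¹' F, edist t.1.1 t.2 ^ p ∂Q ω ∂P := by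
    refine lintegral_congr fun ω => ?_
    rw [Kernel.map_apply _ (by fun_prop),
      setLIntegral_map (measurable_snd hFm) (by fun_prop) (by fun_prop)]
    rfl
  rw [e₁, e₂, e₃]
  exact rpow_lintegral_edist_le hFm hp

theorem wassersteinW_triangle [StandardBorelSpace M] [Nonempty M]
    (hlam_rm : IsRandomMeasure lam) (hlam : IsEquivariant G lam)
    (hξ_rm : IsRandomMeasure ξ) (hξ : IsEquivariant G ξ) (hξ_unit : HasUnitIntensity P m ξ)
    (hμ_unit : HasUnitIntensity P m μ)
    (hF : IsFundamentalRegion G F) (hmF : m F ≠ ∞) {U : Set M} (hFU : F ⊆ U) (hU : IsOpen U)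
    (hUc : IsCompact (closure U)) {p : ℝ} (hp : 1 ≤ p) :
    wassersteinW G P m p lam μ ≤ wassersteinW G P m p lam ξ + wassersteinW G P m p ξ μ := by
  have hp0 : 0 < p := zero_lt_one.trans_le hp
  rw [wassersteinW_eq_iInf P m hp0 lam ξ, wassersteinW_eq_iInf P m hp0 ξ μ]
  refine ENNReal.le_iInf_add_iInf fun q₁ q₂ => ?_
  obtain ⟨q₃, hq₃, hle⟩ := q₁.2.exists_rpow_meanCost_le hlam_rm hlam hξ_rm hξ hξ_unit hμ_unit
    q₂.2 hF hmF hFU hU hUc hp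
  refine le_trans ?_ hle
  exact ENNReal.rpow_le_rpow (iInf₂_le q₃ hq₃) (by positivity)

end Triangle

/-! ### The metric properties on the manifold -/

theorem mainTheorem7
    (n : ℕ) {M : Type*} [MetricSpace M] [SecondCountableTopology M] [CompleteSpace M]
    [ConnectedSpace M] [NoncompactSpace M]
    [ChartedSpace (EuclideanSpace ℝ (Fin n)) M] [IsManifold (𝓡 n) ((⊤ : ℕ∞) : WithTop ℕ∞) M]
    [RiemannianBundle (fun x : M => TangentSpace (𝓡 n) x)]
    [IsContMDiffRiemannianBundle (𝓡 n) ((⊤ : ℕ∞) : WithTop ℕ∞) (EuclideanSpace ℝ (Fin n))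
      (fun x : M => TangentSpace (𝓡 n) x)]
    [IsRiemannianManifold (𝓡 n) M]
    [MeasurableSpace M] [BorelSpace M]
    {G : Type*} [Group G] [MulAction G M] [IsIsometricSMul G M]
    (hG_disc : IsProperlyDiscontinuousAction G M) (hG_cocpt : IsCocompactAction G M)
    (hG_free : IsFreeAction G M)
    {Ω : Type*} [MeasurableSpace Ω] (P : Measure Ω) [IsProbabilityMeasure P]
    [MulAction G Ω] [MeasurableConstSMul G Ω] [SMulInvariantMeasure G Ω P]
    (p : ℝ) (hp : 1 ≤ p)
    (lam μ ξ : Kernel Ω M)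
    (hlam : IsRandomMeasure lam) (hlam_equiv : IsEquivariant G lam)
    (hlam_unit : HasUnitIntensity P (riemannianVolume n M) lam)
    (hμ : IsRandomMeasure μ) (hμ_equiv : IsEquivariant G μ)
    (hμ_unit : HasUnitIntensity P (riemannianVolume n M) μ)
    (hξ : IsRandomMeasure ξ) (hξ_equiv : IsEquivariant G ξ)
    (hξ_unit : HasUnitIntensity P (riemannianVolume n M) ξ) :
    (wassersteinW G P (riemannianVolume n M) p lam μ = 0 ↔ ∀ᵐ ω ∂P, lam ω = μ ω) ∧
    wassersteinW G P (riemannianVolume n M) p lam μ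
      = wassersteinW G P (riemannianVolume n M) p μ lam ∧
    wassersteinW G P (riemannianVolume n M) p lam μ
      ≤ wassersteinW G P (riemannianVolume n M) p lam ξ
        + wassersteinW G P (riemannianVolume n M) p ξ μ ∧
    (∀ q : Kernel Ω (M × M), IsEquivariantSemicoupling G P q lam μ →
      ∀ᵐ ω ∂P, IsCoupling (q ω) (lam ω) (μ ω)) := by
  have : LocallyCompactSpace M := Manifold.locallyCompact_of_finiteDimensional (𝓡 n)
  have : Countable G := hG_disc.countable
  have : IsManifold (𝓡 n) 1 M := IsManifold.of_le (n := ((⊤ : ℕ∞) : WithTop ℕ∞)) (by simp)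
  have : IsContinuousRiemannianBundle (EuclideanSpace ℝ (Fin n))
      (fun x : M => TangentSpace (𝓡 n) x) := by
    obtain ⟨g, hg, hg'⟩ := IsContMDiffRiemannianBundle.exists_contMDiff (IB := 𝓡 n)
      (n := ((⊤ : ℕ∞) : WithTop ℕ∞)) (F := EuclideanSpace ℝ (Fin n))
      (E := fun x : M => TangentSpace (𝓡 n) x)
    exact ⟨g, hg.continuous, hg'⟩
  have : IsLocallyFiniteMeasure (riemannianVolume n M) := isLocallyFiniteMeasure_riemannianVolume
  obtain ⟨F, U, hF, hFU, hU, hUc⟩ := exists_isFundamentalRegion hG_disc hG_free hG_cocpt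
  have hmF : riemannianVolume n M F ≠ ∞ :=
    ((measure_mono (hFU.trans subset_closure)).trans_lt hUc.measure_lt_top).ne
  have hp0 : 0 < p := zero_lt_one.trans_le hp
  refine ⟨⟨fun hW => ?_, fun h => ?_⟩, ?_, ?_, fun q hq => ?_⟩
  · exact ae_eq_of_wassersteinW_eq_zero hlam hlam_equiv hlam_unit hμ_equiv hμ_unit hF hmF hp0 hW
  · exact wassersteinW_eq_zero_of_ae_eq hlam hlam_equiv h hp0
  · exact le_antisymm (wassersteinW_le_swap hμ_equiv hμ_unit hlam_unit hF hmF hp0.le)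
      (wassersteinW_le_swap hlam_equiv hlam_unit hμ_unit hF hmF hp0.le)
  · exact wassersteinW_triangle hlam hlam_equiv hξ hξ_equiv hξ_unit hμ_unit hF hmF hFU hU hUc hp
  · exact hq.ae_isCoupling hlam_equiv hlam_unit hμ_unit hF hmF
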